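/- **Conventions.** Let $\mathcal F$ be the fermionic Fock space of finite complex linear combinations of semi-infinite wedges $e_{l_1}\wedge e_{l_2}\wedge\cdots$ ($l_1>l_2>\cdots$ integers, with all but finitely many negative integers and only finitely many nonnegative integers occurring). Set $\psi_j=e_j\wedge$, $\psi_j^\dagger=i_{e^j}$, $|0\rangle=e_{-1}\wedge e_{-2}\wedge\cdots$, $\psi(z)=\sum_{j\in\mathbb Z}\psi_jz^j$, $\psi^\dagger(z)=\sum_{j\in\mathbb Z}\psi^\dagger_jz^{-j-1}$. Let $\tilde A=(\tilde A_{jk})_{j,k\in\mathbb Z}$ be a complex matrix with $\tilde A_{jk}=0$ for $j\ge k$, and put $g=e^{\tilde A}$, $\hat g(\tilde A)=\exp\big(\sum_{j,k}\tilde A_{jk}{:}\psi_j\psi^\dagger_k{:}\big)$, where ${:}L_1L_2{:}=L_1L_2-\langle0|L_1L_2|0\rangle$. Let $\lambda$ be a partition with Frobenius indices $(\alpha_1,\dots,\alpha_r|\beta_1,\dots,\beta_r)$ and $|\lambda\rangle=(-1)^{\sum_j\beta_j}\prod_{j=1}^r\psi_{\alpha_j}\psi^\dagger_{-\beta_j-1}|0\rangle$.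 For $\mathbf t=(t_1,t_2,\dots)$ let $\pi_\lambda(\mathbf t)=\langle0|\exp\big(\sum_{j\ge1}t_j\sum_{k\in\mathbb Z}\psi_k\psi^\dagger_{k+j}\big)\hat g(\tilde A)|\lambda\rangle$. For $n\ge0$ and $\mathbf x,\mathbf y\in\mathbb C^n$ let $[\mathbf x]-[\mathbf y]$ be the sequence with $t_j=\frac1j\sum_{a=1}^n(x_a^j-y_a^j)$. Define $$p_j(x|\tilde A)=\sum_{k=0}^jg_{kj}x^k,\qquad p^*_j(y|\tilde A)=\sum_{k=0}^j(g^{-1})_{-j-1,-k-1}\,y^k,$$ $$G_{ij}=(-1)^{\beta_i}\sum_{k=0}^{\beta_i}g_{-k-1,\alpha_j}\,(g^{-1})_{-\beta_i-1,-k-1}\quad(1\le i,j\le r),$$ and the $(n+r)\times(n+r)$ matrix $$\mathbf N(\mathbf x,\mathbf y)=\begin{pmatrix}\Big(\dfrac{x_ay_b}{y_b-x_a}\Big)_{a,b\le n}&\big(x_a\,p_{\alpha_j}(x_a|\tilde A)\big)_{a\le n,\,j\le r}\\[2mm]\big((-1)^{\beta_i}y_b\,p^*_{\beta_i}(y_b|\tilde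 A)\big)_{i\le r,\,b\le n}&\big(G_{ij}\big)_{i,j\le r}\end{pmatrix}.$$ **Proposition 5.1.** (i) The KP $n$-pair correlator $$K_{n,\lambda}(\mathbf x,\mathbf y|\tilde A)=\langle0|\prod_{a=1}^n\psi^\dagger(x_a^{-1})\psi(y_a^{-1})\;\hat g(\tilde A)|\lambda\rangle,$$ understood as the sum of its mode expansion, converges absolutely in the radially ordered domain $0<|x_1|<|y_1|<|x_2|<|y_2|<\cdots<|x_n|<|y_n|$, and there $$K_{n,\lambda}(\mathbf x,\mathbf y|\tilde A)=\det\mathbf N(\mathbf x,\mathbf y).$$ (ii) Hence $K_{n,\lambda}$ is a rational function whose only poles are (at most) simple ones along $x_a=y_b$: there is a polynomial $P$ in $(\mathbf x,\mathbf y)$ such that $\det\mathbf N(\mathbf x,\mathbf y)=P(\mathbf x,\mathbf y)/\prod_{a,b=1}^n(x_a-y_b)$ whenever $x_a\ne y_b$ for all $a,b$. (iii) In the radially ordered domain, $$K_{n,\lambda}(\mathbf x,\mathbf y|\tilde A)=(-1)^n\Big(\prod_{a=1}^nx_ay_a\Big)\det\Big(\frac1{x_a-y_b}\Big)_{a,b\le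 n}\,\pi_\lambda([\mathbf x]-[\mathbf y]),$$ and $\big(\prod_{a=1}^nx_ay_a\big)\,\pi_\lambda([\mathbf x]-[\mathbf y])$ is a polynomial in $(\mathbf x,\mathbf y)$. -/

import Mathlib

namespace KPFock

noncomputable section

open scoped Classical

/-! ### Fermionic Fock space -/

/-- A basis state of the semi-infinite wedge space, given by its set of occupied sites:
`S = {l₁ > l₂ > ⋯}` stands for `e_{l₁} ∧ e_{l₂} ∧ ⋯`. It differs from the filled sea of negative
integers in finitely many sites. -/
@[ext]
structure Maya where
  /-- the set of occupied sites -/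
  occ : Set ℤ
  finite_particles : {k : ℤ | k ∈ occ ∧ 0 ≤ k}.Finite
  finite_holes : {k : ℤ | k ∉ occ ∧ k < 0}.Finite

/-- The Dirac sea `e_{-1} ∧ e_{-2} ∧ ⋯`. -/
def Maya.sea : Maya where
  occ := {k | k < 0}
  finite_particles := by
    convert Set.finite_empty (α := ℤ)
    ext k; simp
  finite_holes := by
    convert Set.finite_empty (α := ℤ)
    ext k; simp

/-- Occupy the site `j`. -/
def Maya.fill (S : Maya) (j : ℤ) : Maya where
  occ := insert j S.occ
  finite_particles := (S.finite_particles.insert j).subset (by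
    rintro k ⟨h | h, hk⟩
    · exact Or.inl h
    · exact Or.inr ⟨h, hk⟩)
  finite_holes := S.finite_holes.subset (by
    rintro k ⟨h, hk⟩
    exact ⟨fun h' => h (Or.inr h'), hk⟩)

/-- Empty the site `j`. -/
def Maya.clear (S : Maya) (j : ℤ) : Maya where
  occ := S.occ \ {j}
  finite_particles := S.finite_particles.subset (by
    rintro k ⟨h, hk⟩
    exact ⟨h.1, hk⟩)
  finite_holes := (S.finite_holes.insert j).subset (by
    rintro k ⟨h, hk⟩
    by_cases hj : k = j
    · exact Or.inl hj
    · exact Or.inr ⟨fun h' => h ⟨h', hj⟩, hk⟩)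

/-- The number of occupied sites strictly to the right of `j`; this is the number of factors
of the wedge that `e_j` or `i_{e^j}` has to pass. -/
def Maya.above (S : Maya) (j : ℤ) : ℕ := {k : ℤ | k ∈ S.occ ∧ j < k}.ncard

/-- The (algebraic) fermionic Fock space: finite linear combinations of basis states. -/
abbrev Fock : Type := Maya →₀ ℂ

/-- Linear operators on Fock space. -/
abbrev Op : Type := Module.End ℂ Fock

/-- The basis vector of a state. -/
def ket (S : Maya) : Fock := Finsupp.single S 1

/-- The vacuum `|0⟩`. -/
def vac : Fock := ket Maya.sea

/-- The vacuum expectation value `⟨0| T |0⟩`. -/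
def vev (T : Op) : ℂ := T vac Maya.sea

/-- Creation operator `ψ_j = e_j ∧`. -/
def psi (j : ℤ) : Op :=
  Finsupp.linearCombination ℂ fun S : Maya =>
    if j ∈ S.occ then 0 else (-1 : ℂ) ^ S.above j • ket (S.fill j)

/-- Annihilation operator `ψ†_j = i_{e^j}`. -/
def psiDag (j : ℤ) : Op :=
  Finsupp.linearCombination ℂ fun S : Maya =>
    if j ∈ S.occ then (-1 : ℂ) ^ S.above j • ket (S.clear j) else 0

/-- Normal ordering of a product of two linear elements. -/
def normalOrder (L₁ L₂ : Op) : Op := L₁ * L₂ - vev (L₁ * L₂) • (1 : Op)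

/-- The pointwise sum `∑ i, T i` of a family of operators of which, on each basis state, only
finitely many do not vanish. -/
def opSum {ι : Type} (T : ι → Op) : Op :=
  Finsupp.linearCombination ℂ fun S : Maya => ∑ᶠ i : ι, T i (ket S)

/-- The exponential series `∑ m, T ^ m / m!` of a locally nilpotent operator. -/
def opExp (T : Op) : Op := opSum fun m : ℕ => ((m.factorial : ℂ)⁻¹) • T ^ m

/-- The operator `∑_{j,k} A_{jk} :ψ_j ψ†_k:`. -/
def hatAlg (A : Matrix ℤ ℤ ℂ) : Op :=
  opSum fun p : ℤ × ℤ => A p.1 p.2 • normalOrder (psi p.1) (psiDag p.2)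

/-- The fermionic group element `ĝ(A) = exp (∑ A_{jk} :ψ_j ψ†_k:)`. -/
def hatG (A : Matrix ℤ ℤ ℂ) : Op := opExp (hatAlg A)

/-- The current component `J_j = ∑_k ψ_k ψ†_{k+j}`, `j ≥ 1`. -/
def current (j : ℕ+) : Op := opSum fun k : ℤ => psi k * psiDag (k + ((j : ℕ) : ℤ))

/-- The KP shift flows `γ̂₊(t) = exp (∑_{j ≥ 1} t_j J_j)`. -/
def hatGamma (t : ℕ+ → ℂ) : Op := opExp (opSum fun j : ℕ+ => t j • current j)

/-! ### Partitions in Frobenius notation and their states -/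

/-- Frobenius rank: the number of diagonal cells. -/
def frobRank (lam : YoungDiagram) : ℕ := (lam.cells.filter fun c => c.1 = c.2).card

/-- Frobenius arm `α_j`: the number of cells to the right of the `j`-th diagonal cell
(indices start at `0`). -/
def arm (lam : YoungDiagram) (j : Fin (frobRank lam)) : ℕ := lam.rowLen j - (j + 1)

/-- Frobenius leg `β_j`: the number of cells below the `j`-th diagonal cell. -/
def leg (lam : YoungDiagram) (j : Fin (frobRank lam)) : ℕ := lam.colLen j - (j + 1)

/-- The state `|λ⟩ = (-1)^{∑ β_j} ∏_j ψ_{α_j} ψ†_{-β_j-1} |0⟩`. -/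
def ketPartition (lam : YoungDiagram) : Fock :=
  (-1 : ℂ) ^ (∑ j, leg lam j) •
    (List.ofFn fun j => psi (arm lam j : ℤ) * psiDag (-(leg lam j : ℤ) - 1)).prod vac

/-! ### The tau function and the correlator -/

/-- The KP tau function `π_λ(g(A))(t) = ⟨0| γ̂₊(t) ĝ(A) |λ⟩`. -/
def tau (A : Matrix ℤ ℤ ℂ) (lam : YoungDiagram) (t : ℕ+ → ℂ) : ℂ :=
  hatGamma t (hatG A (ketPartition lam)) Maya.sea

/-- The difference of normalized power sums `t_j = (1/j) ∑_a (x_a^j - y_a^j)`. -/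
def powerSumDiff {n : ℕ} (x y : Fin n → ℂ) (j : ℕ+) : ℂ :=
  1 / ((j : ℕ) : ℂ) * ∑ a, (x a ^ (j : ℕ) - y a ^ (j : ℕ))

/-- Coefficient of `ψ_j` in the field `ψ(z) = ∑_j ψ_j z^j`. -/
def psiCoeff (z : ℂ) (j : ℤ) : ℂ := z ^ j

/-- Coefficient of `ψ†_j` in the field `ψ†(z) = ∑_j ψ†_j z^{-j-1}`. -/
def psiDagCoeff (z : ℂ) (j : ℤ) : ℂ := z ^ (-j - 1)

/-- The term of the mode expansion of `⟨0| ∏_a ψ†(x_a⁻¹) ψ(y_a⁻¹) ĝ(A) |λ⟩` that takes the mode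
`ψ†_{(m a).1}` from `ψ†(x_a⁻¹)` and the mode `ψ_{(m a).2}` from `ψ(y_a⁻¹)`. -/
def correlatorTerm (A : Matrix ℤ ℤ ℂ) (lam : YoungDiagram) {n : ℕ} (x y : Fin n → ℂ)
    (m : Fin n → ℤ × ℤ) : ℂ :=
  (∏ a, psiDagCoeff (x a)⁻¹ (m a).1 * psiCoeff (y a)⁻¹ (m a).2) *
    (List.ofFn fun a => psiDag (m a).1 * psi (m a).2).prod (hatG A (ketPartition lam)) Maya.sea

/-- The `n`-pair correlator
`K_{n,λ}(x,y|A) = ⟨0| ∏_a ψ†(x_a⁻¹) ψ(y_a⁻¹) ĝ(A) |λ⟩`, the sum of its mode expansion. -/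
def correlator (A : Matrix ℤ ℤ ℂ) (lam : YoungDiagram) {n : ℕ} (x y : Fin n → ℂ) : ℂ :=
  ∑' m : Fin n → ℤ × ℤ, correlatorTerm A lam x y m

/-- The radially ordered domain `0 < |x₁| < |y₁| < |x₂| < |y₂| < ⋯ < |x_n| < |y_n|`. -/
def RadiallyOrdered {n : ℕ} (x y : Fin n → ℂ) : Prop :=
  (∀ a, 0 < ‖x a‖) ∧ (∀ a, ‖x a‖ < ‖y a‖) ∧ ∀ a b, a < b → ‖y a‖ < ‖x b‖

/-! ### The block matrix -/

/-- `A_{ij} = 0` whenever `i ≥ j`. -/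
def StrictlyUpper (A : Matrix ℤ ℤ ℂ) : Prop := ∀ i j, j ≤ i → A i j = 0

/-- Powers of a doubly infinite triangular matrix. For a strictly upper triangular matrix
every sum has finitely many nonzero terms. -/
def matPow (A : Matrix ℤ ℤ ℂ) : ℕ → Matrix ℤ ℤ ℂ
  | 0 => 1
  | m + 1 => fun i j => ∑ᶠ k : ℤ, A i k * matPow A m k j

/-- The matrix exponential `g(A) = e^A = ∑ m, A ^ m / m!`; for a strictly upper triangular
matrix every entry is a sum with finitely many nonzero terms. Its inverse is `e^{-A}`. -/
def matExp (A : Matrix ℤ ℤ ℂ) : Matrix ℤ ℤ ℂ := fun i j =>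
  ∑ᶠ m : ℕ, (m.factorial : ℂ)⁻¹ * matPow A m i j

/-- `P_{jk} = g_{jk}`. -/
def coeffP (A : Matrix ℤ ℤ ℂ) (j k : ℤ) : ℂ := matExp A j k

/-- `P*_{jk} = (g⁻¹)_{-j-1,-k-1}`. -/
def coeffPStar (A : Matrix ℤ ℤ ℂ) (j k : ℤ) : ℂ := matExp (-A) (-j - 1) (-k - 1)

/-- The polynomial `p_j(x|A) = ∑_{k=0}^j P_{kj} x^k`. -/
def polyP (A : Matrix ℤ ℤ ℂ) (j : ℕ) : Polynomial ℂ :=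
  ∑ k ∈ Finset.range (j + 1), Polynomial.C (coeffP A k j) * Polynomial.X ^ k

/-- The polynomial `p*_j(y|A) = ∑_{k=0}^j P*_{jk} y^k`. -/
def polyPStar (A : Matrix ℤ ℤ ℂ) (j : ℕ) : Polynomial ℂ :=
  ∑ k ∈ Finset.range (j + 1), Polynomial.C (coeffPStar A j k) * Polynomial.X ^ k

/-- The block `⟨0| ψ†(x_a⁻¹) ψ(y_b⁻¹) |0⟩ = x_a y_b / (y_b - x_a)`. -/
def blockN {n : ℕ} (x y : Fin n → ℂ) : Matrix (Fin n) (Fin n) ℂ := fun a b =>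
  x a * y b / (y b - x a)

/-- The block `x_a p_{α_j}(x_a|A)`. -/
def blockW (A : Matrix ℤ ℤ ℂ) (lam : YoungDiagram) {n : ℕ} (x : Fin n → ℂ) :
    Matrix (Fin n) (Fin (frobRank lam)) ℂ := fun a j =>
  x a * (polyP A (arm lam j)).eval (x a)

/-- The block `(-1)^{β_i} y_b p*_{β_i}(y_b|A)`. -/
def blockWStar (A : Matrix ℤ ℤ ℂ) (lam : YoungDiagram) {n : ℕ} (y : Fin n → ℂ) :
    Matrix (Fin (frobRank lam)) (Fin n) ℂ := fun i b =>
  (-1) ^ leg lam i * (y b * (polyPStar A (leg lam i)).eval (y b))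

/-- The block `G_{ij} = (-1)^{β_i} ∑_{k=0}^{β_i} P_{-k-1,α_j} P*_{β_i,k}`. -/
def blockG (A : Matrix ℤ ℤ ℂ) (lam : YoungDiagram) :
    Matrix (Fin (frobRank lam)) (Fin (frobRank lam)) ℂ := fun i j =>
  (-1) ^ leg lam i * ∑ k ∈ Finset.range (leg lam i + 1),
    coeffP A (-(k : ℤ) - 1) (arm lam j) * coeffPStar A (leg lam i) k

/-- The `(n+r) × (n+r)` block matrix of the determinantal formula. -/
def blockMatrix (A : Matrix ℤ ℤ ℂ) (lam : YoungDiagram) {n : ℕ} (x y : Fin n → ℂ) :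
    Matrix (Fin n ⊕ Fin (frobRank lam)) (Fin n ⊕ Fin (frobRank lam)) ℂ :=
  Matrix.fromBlocks (blockN x y) (blockW A lam x) (blockWStar A lam y) (blockG A lam)

/-- `Δ(x,y) = det (1 / (x_a - y_b))`. -/
def cauchyDet {n : ℕ} (x y : Fin n → ℂ) : ℂ :=
  (Matrix.of fun a b : Fin n => 1 / (x a - y b)).det

end

end KPFock

namespace KPFock

noncomputable section

open scoped Classical

/-! ### Canonical anticommutation relations -/

lemma Maya.finite_above (S : Maya) (i : ℤ) : {k : ℤ | k ∈ S.occ ∧ i < k}.Finite := by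
  refine (S.finite_particles.union (Set.finite_Ioo i 0)).subset ?_
  rintro k ⟨h, hk⟩
  by_cases h0 : 0 ≤ k
  · exact Or.inl ⟨h, h0⟩
  · exact Or.inr ⟨hk, by omega⟩

@[simp] lemma Maya.mem_fill {S : Maya} {i j : ℤ} : i ∈ (S.fill j).occ ↔ i = j ∨ i ∈ S.occ :=
  Iff.rfl

@[simp] lemma Maya.mem_clear {S : Maya} {i j : ℤ} : i ∈ (S.clear j).occ ↔ i ∈ S.occ ∧ i ≠ j :=
  Iff.rfl

@[simp] lemma Maya.mem_sea {i : ℤ} : i ∈ Maya.sea.occ ↔ i < 0 := Iff.rfl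

lemma Maya.above_fill {S : Maya} {j : ℤ} (hj : j ∉ S.occ) (i : ℤ) :
    (S.fill j).above i = S.above i + if i < j then 1 else 0 := by
  unfold Maya.above
  split_ifs with h
  · rw [← Set.ncard_insert_of_notMem (a := j) (by simp [hj]) (S.finite_above i)]
    congr 1
    ext k
    simp only [Maya.mem_fill, Set.mem_ofPred_eq, Set.mem_insert_iff]
    constructor
    · rintro ⟨h1 | h1, h2⟩ <;> simp [*]
    · rintro (rfl | h1) <;> simp [*]
  · rw [add_zero]
    congr 1
    ext k
    simp only [Maya.mem_fill, Set.mem_ofPred_eq]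
    constructor
    · rintro ⟨rfl | h1, h2⟩
      · exact absurd h2 h
      · exact ⟨h1, h2⟩
    · rintro ⟨h1, h2⟩
      exact ⟨Or.inr h1, h2⟩

lemma Maya.fill_clear {S : Maya} {j : ℤ} (hj : j ∈ S.occ) : (S.clear j).fill j = S := by
  ext k
  by_cases h : k = j <;> simp [h, hj]

lemma Maya.clear_fill {S : Maya} {j : ℤ} (hj : j ∉ S.occ) : (S.fill j).clear j = S := by
  ext k
  by_cases h : k = j <;> simp [h, hj]

lemma Maya.fill_comm (S : Maya) (i j : ℤ) : (S.fill i).fill j = (S.fill j).fill i := by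
  ext k
  simp only [Maya.mem_fill]
  tauto

lemma Maya.clear_comm (S : Maya) (i j : ℤ) : (S.clear i).clear j = (S.clear j).clear i := by
  ext k
  simp only [Maya.mem_clear]
  tauto

lemma Maya.fill_clear_comm (S : Maya) {i j : ℤ} (h : i ≠ j) :
    (S.fill i).clear j = (S.clear j).fill i := by
  ext k
  simp only [Maya.mem_clear, Maya.mem_fill]
  grind

/-- The sign picked up by `e_j` or `i_{e^j}` when it is moved to its place. -/
def Maya.sgn (S : Maya) (j : ℤ) : ℂ := (-1) ^ S.above j

lemma Maya.sgn_mul_self (S : Maya) (j : ℤ) : S.sgn j * S.sgn j = 1 := by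
  rw [Maya.sgn, ← mul_pow]
  simp

lemma Maya.sgn_fill {S : Maya} {j : ℤ} (hj : j ∉ S.occ) (i : ℤ) :
    (S.fill j).sgn i = if i < j then -S.sgn i else S.sgn i := by
  rw [Maya.sgn, Maya.above_fill hj, Maya.sgn]
  split_ifs <;> simp [pow_succ]

lemma Maya.sgn_clear {S : Maya} {j : ℤ} (hj : j ∈ S.occ) (i : ℤ) :
    (S.clear j).sgn i = if i < j then -S.sgn i else S.sgn i := by
  have h := Maya.sgn_fill (S := S.clear j) (j := j) (by simp) i
  rw [Maya.fill_clear hj] at h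
  split_ifs at h ⊢ <;> simp [h]

lemma psi_ket (j : ℤ) (S : Maya) :
    psi j (ket S) = if j ∈ S.occ then 0 else S.sgn j • ket (S.fill j) := by
  simp [psi, ket, Maya.sgn, Finsupp.linearCombination_single]

lemma psiDag_ket (j : ℤ) (S : Maya) :
    psiDag j (ket S) = if j ∈ S.occ then S.sgn j • ket (S.clear j) else 0 := by
  simp [psiDag, ket, Maya.sgn, Finsupp.linearCombination_single]

lemma op_ext {T U : Op} (h : ∀ S, T (ket S) = U (ket S)) : T = U := by
  refine Finsupp.lhom_ext' fun S => LinearMap.ext_ring ?_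
  exact h S

lemma psi_anticomm (i j : ℤ) : psi i * psi j = -(psi j * psi i) := by
  refine op_ext fun S => ?_
  simp only [Module.End.mul_apply, LinearMap.neg_apply, psi_ket]
  by_cases hi : i ∈ S.occ <;> by_cases hj : j ∈ S.occ <;>
    simp only [hi, hj, if_true, if_false, map_zero, neg_zero, map_smul, psi_ket, Maya.mem_fill,
      or_true, smul_zero, or_false]
  by_cases hij : i = j
  · simp [hij]
  · rw [if_neg hij, if_neg (Ne.symm hij), Maya.sgn_fill hi, Maya.sgn_fill hj, smul_smul, smul_smul,
      Maya.fill_comm, ← neg_smul]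
    congr 1
    rcases lt_or_gt_of_ne hij with h | h
    · rw [if_pos h, if_neg h.not_gt]; ring
    · rw [if_pos h, if_neg h.not_gt]; ring

lemma psiDag_anticomm (i j : ℤ) : psiDag i * psiDag j = -(psiDag j * psiDag i) := by
  refine op_ext fun S => ?_
  simp only [Module.End.mul_apply, LinearMap.neg_apply, psiDag_ket]
  by_cases hi : i ∈ S.occ <;> by_cases hj : j ∈ S.occ <;>
    simp only [hi, hj, if_true, if_false, map_zero, neg_zero, map_smul, psiDag_ket, Maya.mem_clear,
      false_and, smul_zero, true_and]
  by_cases hij : i = j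
  · simp [hij]
  · rw [if_pos hij, if_pos (Ne.symm hij), Maya.sgn_clear hi, Maya.sgn_clear hj, smul_smul,
      smul_smul, Maya.clear_comm, ← neg_smul]
    congr 1
    rcases lt_or_gt_of_ne hij with h | h
    · rw [if_pos h, if_neg h.not_gt]; ring
    · rw [if_pos h, if_neg h.not_gt]; ring

lemma psi_psiDag_anticomm (i j : ℤ) :
    psi i * psiDag j + psiDag j * psi i = if i = j then 1 else 0 := by
  refine op_ext fun S => ?_
  simp only [Module.End.mul_apply, LinearMap.add_apply, psi_ket, psiDag_ket]
  by_cases hij : i = j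
  · subst hij
    by_cases hi : i ∈ S.occ
    · simp [hi, psi_ket, Maya.sgn_clear hi, smul_smul, Maya.sgn_mul_self, Maya.fill_clear hi]
    · simp [hi, psiDag_ket, Maya.sgn_fill hi, smul_smul, Maya.sgn_mul_self, Maya.clear_fill hi]
  · have hji := Ne.symm hij
    by_cases hi : i ∈ S.occ <;> by_cases hj : j ∈ S.occ <;>
      simp [hi, hj, hij, hji, psi_ket, psiDag_ket]
    rw [Maya.sgn_clear hj, Maya.sgn_fill hi, smul_smul, smul_smul, Maya.fill_clear_comm _ hij,
      ← add_smul]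
    convert zero_smul ℂ _
    rcases lt_or_gt_of_ne hij with h | h
    · rw [if_pos h, if_neg h.not_gt]; ring
    · rw [if_pos h, if_neg h.not_gt]; ring

/-! ### The vacuum -/

lemma psi_vac {k : ℤ} (hk : k < 0) : psi k vac = 0 := by
  simp [vac, psi_ket, hk]

lemma psiDag_vac {k : ℤ} (hk : 0 ≤ k) : psiDag k vac = 0 := by
  simp [vac, psiDag_ket, not_lt.2 hk]

lemma vac_sea : vac Maya.sea = 1 := by
  simp [vac, ket]

lemma fock_induction {p : Fock → Prop} (h0 : p 0) (hadd : ∀ a b, p a → p b → p (a + b))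
    (hsmul : ∀ (c : ℂ) a, p a → p (c • a)) (hket : ∀ S, p (ket S)) (φ : Fock) : p φ := by
  induction φ using Finsupp.induction_linear with
  | zero => exact h0
  | add f g hf hg => exact hadd f g hf hg
  | single S c =>
    have : Finsupp.single S c = c • ket S := by simp [ket]
    rw [this]
    exact hsmul _ _ (hket S)

lemma ket_sea_of_ne {S : Maya} {k : ℤ} (h : ¬(k ∈ S.occ ↔ k < 0)) : ket S Maya.sea = 0 := by
  rw [ket, Finsupp.single_apply, if_neg]
  rintro rfl
  simp at h

lemma psi_apply_sea {k : ℤ} (hk : 0 ≤ k) (φ : Fock) : psi k φ Maya.sea = 0 := by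
  induction φ using fock_induction with
  | h0 => simp
  | hadd a b ha hb => simp [ha, hb]
  | hsmul c a ha => simp [ha]
  | hket S =>
    rw [psi_ket]
    split_ifs
    · rfl
    · rw [Finsupp.smul_apply, ket_sea_of_ne (k := k) (by simp [hk]), smul_zero]

lemma psiDag_apply_sea {k : ℤ} (hk : k < 0) (φ : Fock) : psiDag k φ Maya.sea = 0 := by
  induction φ using fock_induction with
  | h0 => simp
  | hadd a b ha hb => simp [ha, hb]
  | hsmul c a ha => simp [ha]
  | hket S =>
    rw [psiDag_ket]
    split_ifs
    · rw [Finsupp.smul_apply, ket_sea_of_ne (k := k) (by simp [hk]), smul_zero]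
    · rfl

/-! ### Abstract fermionic modes -/

/-- Operators that satisfy the canonical anticommutation relations, with a vacuum and a dual
vacuum. -/
structure FermionModes (F : Type) [AddCommGroup F] [Module ℂ F] where
  /-- creation operators -/
  psi : ℤ → Module.End ℂ F
  /-- annihilation operators -/
  psiDag : ℤ → Module.End ℂ F
  /-- the vacuum -/
  vac : F
  /-- the dual vacuum -/
  covac : F →ₗ[ℂ] ℂ
  psi_anticomm : ∀ i j, psi i * psi j = -(psi j * psi i)
  psiDag_anticomm : ∀ i j, psiDag i * psiDag j = -(psiDag j * psiDag i)
  psi_psiDag : ∀ i j, psi i * psiDag j + psiDag j * psi i = if i = j then 1 else 0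
  psi_vac : ∀ k < 0, psi k vac = 0
  psiDag_vac : ∀ k, 0 ≤ k → psiDag k vac = 0
  covac_psi : ∀ k, 0 ≤ k → ∀ φ, covac (psi k φ) = 0
  covac_psiDag : ∀ k < 0, ∀ φ, covac (psiDag k φ) = 0
  covac_vac : covac vac = 1

/-- The modes acting on Fock space. -/
def fockModes : FermionModes Fock where
  psi := psi
  psiDag := psiDag
  vac := vac
  covac := Finsupp.lapply Maya.sea
  psi_anticomm := psi_anticomm
  psiDag_anticomm := psiDag_anticomm
  psi_psiDag := psi_psiDag_anticomm
  psi_vac _ := psi_vac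
  psiDag_vac _ := psiDag_vac
  covac_psi _ := psi_apply_sea
  covac_psiDag _ := psiDag_apply_sea
  covac_vac := vac_sea

namespace FermionModes

variable {F : Type} [AddCommGroup F] [Module ℂ F] (f : FermionModes F) {W : Finset ℤ}

/-- The operator `∑_k v_k ψ_k`. -/
def creation (W : Finset ℤ) : (W → ℂ) →ₗ[ℂ] Module.End ℂ F :=
  Fintype.linearCombination ℂ fun k : W => f.psi k

/-- The operator `∑_k w_k ψ†_k`. -/
def annihilation (W : Finset ℤ) : (W → ℂ) →ₗ[ℂ] Module.End ℂ F :=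
  Fintype.linearCombination ℂ fun k : W => f.psiDag k

lemma creation_apply (v : W → ℂ) : f.creation W v = ∑ k, v k • f.psi k := rfl

lemma annihilation_apply (w : W → ℂ) : f.annihilation W w = ∑ k, w k • f.psiDag k := rfl

lemma creation_mul_creation (v v' : W → ℂ) :
    f.creation W v * f.creation W v' = -(f.creation W v' * f.creation W v) := by
  simp only [creation_apply, Finset.sum_mul_sum]
  rw [Finset.sum_comm, ← Finset.sum_neg_distrib]
  refine Finset.sum_congr rfl fun i _ => ?_
  rw [← Finset.sum_neg_distrib]
  refine Finset.sum_congr rfl fun j _ => ?_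
  rw [smul_mul_smul_comm, smul_mul_smul_comm, f.psi_anticomm, mul_comm, smul_neg]

lemma annihilation_mul_annihilation (w w' : W → ℂ) :
    f.annihilation W w * f.annihilation W w' =
      -(f.annihilation W w' * f.annihilation W w) := by
  simp only [annihilation_apply, Finset.sum_mul_sum]
  rw [Finset.sum_comm, ← Finset.sum_neg_distrib]
  refine Finset.sum_congr rfl fun i _ => ?_
  rw [← Finset.sum_neg_distrib]
  refine Finset.sum_congr rfl fun j _ => ?_
  rw [smul_mul_smul_comm, smul_mul_smul_comm, f.psiDag_anticomm, mul_comm, smul_neg]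

lemma creation_annihilation (v w : W → ℂ) :
    f.creation W v * f.annihilation W w + f.annihilation W w * f.creation W v =
      (w ⬝ᵥ v) • 1 := by
  simp only [creation_apply, annihilation_apply, Finset.sum_mul_sum]
  rw [Finset.sum_comm, ← Finset.sum_add_distrib, dotProduct, Finset.sum_smul]
  refine Finset.sum_congr rfl fun i _ => ?_
  rw [← Finset.sum_add_distrib, Finset.sum_eq_single i]
  · rw [smul_mul_smul_comm, smul_mul_smul_comm, mul_comm (v i), ← smul_add, f.psi_psiDag,
      if_pos rfl]
  · intro j _ hj
    rw [smul_mul_smul_comm, smul_mul_smul_comm, mul_comm (v j), ← smul_add, f.psi_psiDag,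
      if_neg (fun h => hj (Subtype.ext h)), smul_zero]
  · simp

lemma annihilation_mul_creation (w v : W → ℂ) :
    f.annihilation W w * f.creation W v =
      (w ⬝ᵥ v) • 1 - f.creation W v * f.annihilation W w := by
  rw [← f.creation_annihilation, add_sub_cancel_left]

lemma creation_mul_annihilation (v w : W → ℂ) :
    f.creation W v * f.annihilation W w =
      (w ⬝ᵥ v) • 1 - f.annihilation W w * f.creation W v := by
  rw [← f.creation_annihilation, add_sub_cancel_right]

end FermionModes

/-- The part of a coefficient vector at nonnegative sites. -/
def nonnegPart {W : Finset ℤ} (v : W → ℂ) : W → ℂ := fun k => if 0 ≤ (k : ℤ) then v k else 0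

/-- The part of a coefficient vector at negative sites. -/
def negPart {W : Finset ℤ} (v : W → ℂ) : W → ℂ := fun k => if 0 ≤ (k : ℤ) then 0 else v k

lemma nonnegPart_add_negPart {W : Finset ℤ} (v : W → ℂ) : nonnegPart v + negPart v = v := by
  ext k
  simp only [nonnegPart, negPart, Pi.add_apply]
  split_ifs <;> simp

namespace FermionModes

variable {F : Type} [AddCommGroup F] [Module ℂ F] (f : FermionModes F) {W : Finset ℤ}

lemma annihilation_nonnegPart_vac (w : W → ℂ) : f.annihilation W (nonnegPart w) f.vac = 0 := by
  rw [annihilation_apply, LinearMap.sum_apply]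
  refine Finset.sum_eq_zero fun k _ => ?_
  rw [nonnegPart]
  split_ifs with h
  · rw [LinearMap.smul_apply, f.psiDag_vac _ h, smul_zero]
  · simp

lemma covac_creation (v : W → ℂ) (φ : F) :
    f.covac (f.creation W v φ) = f.covac (f.creation W (negPart v) φ) := by
  simp only [creation_apply, LinearMap.sum_apply, map_sum]
  refine Finset.sum_congr rfl fun k _ => ?_
  rw [negPart]
  split_ifs with h
  · simp [f.covac_psi _ h]
  · rfl

lemma covac_annihilation (w : W → ℂ) (φ : F) :
    f.covac (f.annihilation W w φ) = f.covac (f.annihilation W (nonnegPart w) φ) := by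
  simp only [annihilation_apply, LinearMap.sum_apply, map_sum]
  refine Finset.sum_congr rfl fun k _ => ?_
  rw [nonnegPart]
  split_ifs with h
  · rfl
  · simp [f.covac_psiDag _ (not_le.1 h)]

end FermionModes

/-! ### Wick's theorem -/

lemma det_border {n : ℕ} {R : Type*} [CommRing R] (M : Matrix (Fin (n + 1)) (Fin (n + 1)) R) :
    M.det = (M 0 0 + 1) * (M.submatrix Fin.succ Fin.succ).det -
      (Matrix.of fun i j : Fin n => M i.succ j.succ + M i.succ 0 * M 0 j.succ).det := by
  have hsplit : M.det = (M.updateRow 0 (Pi.single 0 (M 0 0 + 1))).det +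
      (M.updateRow 0 (Fin.cons (-1) fun j => M 0 j.succ)).det := by
    rw [← Matrix.det_updateRow_add]
    congr 1
    conv_lhs => rw [← Matrix.updateRow_eq_self M 0]
    congr 1
    ext j
    refine Fin.cases ?_ (fun j => ?_) j <;> simp
  have h1 : (M.updateRow 0 (Pi.single 0 (M 0 0 + 1))).det =
      (M 0 0 + 1) * (M.submatrix Fin.succ Fin.succ).det := by
    rw [Matrix.det_succ_row_zero, Fin.sum_univ_succ]
    simp
    congr 1
  have h2 : (M.updateRow 0 (Fin.cons (-1) fun j => M 0 j.succ)).det =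
      -(Matrix.of fun i j : Fin n => M i.succ j.succ + M i.succ 0 * M 0 j.succ).det := by
    have := Matrix.det_eq_of_forall_row_eq_smul_add_const
      (A := Matrix.of (Fin.cons (Fin.cons (-1) fun j => M 0 j.succ) fun i => Fin.cons 0
        fun j : Fin n => M i.succ j.succ + M i.succ 0 * M 0 j.succ))
      (B := M.updateRow 0 (Fin.cons (-1) fun j => M 0 j.succ))
      (Fin.cons 0 fun i => M i.succ 0) 0 (by simp) (by
        intro i j
        refine Fin.cases ?_ (fun i => ?_) i <;> refine Fin.cases ?_ (fun j => ?_) j <;> simp)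
    rw [← this, Matrix.det_succ_column_zero, Fin.sum_univ_succ]
    simp
    congr 1
  rw [hsplit, h1, h2, sub_eq_add_neg]

section Ring

variable {R : Type*} [Ring R] [Algebra ℂ R]

lemma mul_self_eq_zero_of_anticomm {a : R} (h : a * a = -(a * a)) : a * a = 0 := by
  have h2 : (2 : ℂ) • (a * a) = 0 := by
    rw [two_smul]
    nth_rewrite 1 [h]
    simp
  exact (smul_eq_zero_iff_right (two_ne_zero)).1 h2

lemma one_add_mul_intertwine_right {p q a : R} {c : ℂ} (hqa : q * a = -(a * q))
    (hpa : p * a = c • (1 : R) - a * p) (hqp : q * p = -(p * q)) (hqq : q * q = 0) :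
    (1 + p * q) * a = (a - c • q) * (1 + p * q) := by
  have h1 : p * q * a = -(c • q) + a * (p * q) := by
    rw [mul_assoc, hqa, mul_neg, ← mul_assoc, hpa, sub_mul, smul_mul_assoc, one_mul, mul_assoc]
    abel
  have h2 : q * (p * q) = 0 := by
    rw [← mul_assoc, hqp, neg_mul, mul_assoc, hqq, mul_zero, neg_zero]
  rw [add_mul, one_mul, h1, mul_add, mul_one, sub_mul, smul_mul_assoc, h2, smul_zero]
  abel

lemma one_add_mul_intertwine_left {p q b : R} {d : ℂ} (hpb : p * b = -(b * p))
    (hqb : q * b = d • (1 : R) - b * q) (hpp : p * p = 0) :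
    (1 + p * q) * b = (b + d • p) * (1 + p * q) := by
  have h1 : p * q * b = d • p + b * (p * q) := by
    rw [mul_assoc, hqb, mul_sub, mul_smul_comm, mul_one, ← mul_assoc, hpb, neg_mul, mul_assoc]
    abel
  have h2 : p * (p * q) = 0 := by
    rw [← mul_assoc, hpp, zero_mul]
  rw [add_mul, one_mul, h1, mul_add, mul_one, add_mul, smul_mul_assoc, h2, smul_zero]
  abel

end Ring

lemma mul_prod_ofFn_intertwine {R : Type*} [Ring R] {n : ℕ} {t : R} {X X' : Fin n → R}
    (h : ∀ i, t * X i = X' i * t) :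
    t * (List.ofFn X).prod = (List.ofFn X').prod * t := by
  induction n with
  | zero => simp
  | succ n ih =>
    rw [List.ofFn_succ, List.ofFn_succ, List.prod_cons, List.prod_cons, ← mul_assoc, h, mul_assoc,
      ih fun i => h i.succ, mul_assoc]

section Pairing

variable {W : Finset ℤ}

lemma nonnegPart_dotProduct_eq (w v : W → ℂ) :
    nonnegPart w ⬝ᵥ v = ∑ k : W, if 0 ≤ (k : ℤ) then w k * v k else 0 := by
  simp [dotProduct, nonnegPart, ite_mul]

lemma negPart_dotProduct_eq (w v : W → ℂ) :
    negPart w ⬝ᵥ v = ∑ k : W, if 0 ≤ (k : ℤ) then 0 else w k * v k := by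
  simp [dotProduct, negPart, ite_mul]

lemma nonnegPart_dotProduct_negPart (w v : W → ℂ) : nonnegPart w ⬝ᵥ negPart v = 0 := by
  rw [nonnegPart_dotProduct_eq]
  refine Finset.sum_eq_zero fun k _ => ?_
  split_ifs with h <;> simp [negPart, h]

lemma dotProduct_negPart (w v : W → ℂ) : w ⬝ᵥ negPart v = negPart w ⬝ᵥ v := by
  rw [negPart_dotProduct_eq, dotProduct]
  refine Finset.sum_congr rfl fun k _ => ?_
  split_ifs with h <;> simp [negPart, h]

lemma negPart_negPart (w : W → ℂ) : negPart (negPart w) = negPart w := by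
  ext k
  simp only [negPart]
  split_ifs <;> rfl

lemma negPart_nonnegPart (w : W → ℂ) : negPart (nonnegPart w) = 0 := by
  ext k
  simp only [negPart, nonnegPart]
  split_ifs <;> rfl

lemma nonnegPart_nonnegPart (w : W → ℂ) : nonnegPart (nonnegPart w) = nonnegPart w := by
  ext k
  simp only [nonnegPart]
  split_ifs <;> rfl

lemma negPart_sub_smul (w u : W → ℂ) (c : ℂ) : negPart (w - c • u) = negPart w - c • negPart u := by
  ext k
  simp only [negPart, Pi.sub_apply, Pi.smul_apply]
  split_ifs <;> simp

lemma nonnegPart_sub_smul (w u : W → ℂ) (c : ℂ) :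
    nonnegPart (w - c • u) = nonnegPart w - c • nonnegPart u := by
  ext k
  simp only [nonnegPart, Pi.sub_apply, Pi.smul_apply]
  split_ifs <;> simp

lemma nonnegPart_dotProduct_add_negPart_dotProduct (w v : W → ℂ) :
    nonnegPart w ⬝ᵥ v + negPart w ⬝ᵥ v = w ⬝ᵥ v := by
  rw [← add_dotProduct, nonnegPart_add_negPart]

end Pairing

/-- The matrix of pairings in Wick's theorem. -/
def wickMatrix {W : Finset ℤ} {n : ℕ} (w v : Fin n → W → ℂ) : Matrix (Fin n) (Fin n) ℂ :=
  Matrix.of fun a b => if a ≤ b then nonnegPart (w a) ⬝ᵥ v b else -(negPart (w a) ⬝ᵥ v b)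

namespace FermionModes

variable {F : Type} [AddCommGroup F] [Module ℂ F] (f : FermionModes F) {W : Finset ℤ}

theorem wick {n : ℕ} (w v : Fin n → W → ℂ) :
    f.covac ((List.ofFn fun a => f.annihilation W (w a) * f.creation W (v a)).prod f.vac) =
      (wickMatrix w v).det := by
  induction n with
  | zero => simp [f.covac_vac]
  | succ n ih =>
    set X := (List.ofFn fun a : Fin n =>
      f.annihilation W (w a.succ) * f.creation W (v a.succ)).prod with hX
    set p := f.creation W (negPart (v 0)) with hp
    set q := f.annihilation W (nonnegPart (w 0)) with hq
    set w' : Fin n → W → ℂ := fun a =>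
      w a.succ - (w a.succ ⬝ᵥ negPart (v 0)) • nonnegPart (w 0) with hw'
    set v' : Fin n → W → ℂ := fun a =>
      v a.succ + (nonnegPart (w 0) ⬝ᵥ v a.succ) • negPart (v 0) with hv'
    have hqp : q * p = -(p * q) := by
      rw [hq, hp, f.annihilation_mul_creation, nonnegPart_dotProduct_negPart, zero_smul, zero_sub]
    have hint : (1 + p * q) * X = (List.ofFn fun a : Fin n =>
        f.annihilation W (w' a) * f.creation W (v' a)).prod * (1 + p * q) := by
      refine mul_prod_ofFn_intertwine fun a => ?_
      have h1 := one_add_mul_intertwine_right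
        (f.annihilation_mul_annihilation (nonnegPart (w 0)) (w a.succ))
        (f.creation_mul_annihilation (negPart (v 0)) (w a.succ)) hqp
        (mul_self_eq_zero_of_anticomm (f.annihilation_mul_annihilation _ _))
      have h2 := one_add_mul_intertwine_left
        (f.creation_mul_creation (negPart (v 0)) (v a.succ))
        (f.annihilation_mul_creation (nonnegPart (w 0)) (v a.succ))
        (mul_self_eq_zero_of_anticomm (f.creation_mul_creation _ _))
      rw [← mul_assoc, h1, mul_assoc, h2, ← mul_assoc, hw', hv']
      simp only [map_sub, map_add, map_smul, hp, hq]
    have hvac : (1 + p * q) f.vac = f.vac := by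
      rw [LinearMap.add_apply, Module.End.one_apply, Module.End.mul_apply, hq,
        f.annihilation_nonnegPart_vac, map_zero, add_zero]
    have hX' : f.covac ((1 + p * q) (X f.vac)) = (wickMatrix w' v').det := by
      rw [← ih, ← Module.End.mul_apply, hint, Module.End.mul_apply, hvac]
    have hX0 : f.covac (X f.vac) = (wickMatrix (fun a => w a.succ) fun a => v a.succ).det :=
      ih _ _
    rw [List.ofFn_succ, List.prod_cons, ← hX, Module.End.mul_apply, Module.End.mul_apply,
      f.covac_annihilation, ← Module.End.mul_apply, f.annihilation_mul_creation,
      LinearMap.sub_apply, map_sub, LinearMap.smul_apply, Module.End.one_apply, map_smul,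
      Module.End.mul_apply, f.covac_creation, ← Module.End.mul_apply, ← hq, ← hp]
    rw [LinearMap.add_apply, Module.End.one_apply, map_add] at hX'
    rw [eq_sub_of_add_eq' hX', hX0, det_border]
    have e1 : (wickMatrix w v).submatrix Fin.succ Fin.succ =
        wickMatrix (fun a => w a.succ) fun a => v a.succ := by
      ext a b
      simp [wickMatrix]
    have e2 : (Matrix.of fun i j : Fin n => wickMatrix w v i.succ j.succ +
        wickMatrix w v i.succ 0 * wickMatrix w v 0 j.succ) = wickMatrix w' v' := by
      ext a b
      simp only [wickMatrix, Matrix.of_apply, Fin.succ_le_succ_iff, Fin.zero_le, if_true, hw', hv',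
        (Fin.succ_pos a).not_ge, if_false, nonnegPart_sub_smul, negPart_sub_smul,
        nonnegPart_nonnegPart, negPart_nonnegPart, smul_zero, sub_zero, dotProduct_add,
        sub_dotProduct, dotProduct_smul, smul_dotProduct, zero_dotProduct,
        dotProduct_negPart, smul_eq_mul, negPart_negPart]
      split_ifs <;> ring
    rw [e1, e2]
    simp only [wickMatrix, Matrix.of_apply, le_refl, if_true, smul_eq_mul]
    ring

end FermionModes

/-! ### Conjugation by exponentials of quadratic operators -/

section Leibniz

open TensorProduct

variable {V F : Type} [AddCommGroup V] [Module ℂ V] [Module ℚ V] [AddCommGroup F] [Module ℂ F]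
  [Module ℚ F]

lemma exp_mul_of_leibniz (β : V →ₗ[ℂ] Module.End ℂ F) {B : Module.End ℂ V} {D : Module.End ℂ F}
    (hB : IsNilpotent B) (hD : IsNilpotent D) (h : ∀ v, D * β v = β (B v) + β v * D) (v : V) :
    IsNilpotent.exp D * β v = β (IsNilpotent.exp B v) * IsNilpotent.exp D := by
  let BL : Module.End ℂ (V ⊗[ℂ] F) := B.rTensor F
  let DR : Module.End ℂ (V ⊗[ℂ] F) := D.lTensor V
  have hBL : IsNilpotent BL := hB.map <| Module.End.rTensorAlgHom ℂ V F
  have hDR : IsNilpotent DR := hD.map <| Module.End.lTensorAlgHom ℂ F V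
  have hcomm : Commute BL DR := by ext; simp [BL, DR]
  have h₁ : IsNilpotent.exp D ∘ₗ TensorProduct.lift β =
      TensorProduct.lift β ∘ₗ IsNilpotent.exp (BL + DR) := by
    refine Module.End.commute_exp_left_of_commute (hcomm.isNilpotent_add hBL hDR) hD ?_
    ext v φ
    simpa [BL, DR] using LinearMap.congr_fun (h v) φ
  have h₂ : IsNilpotent.exp BL = (IsNilpotent.exp B).rTensor F :=
    (hB.map_exp (Module.End.rTensorAlgHom ℂ V F)).symm
  have h₃ : IsNilpotent.exp DR = (IsNilpotent.exp D).lTensor V :=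
    (hD.map_exp (Module.End.lTensorAlgHom ℂ F V)).symm
  ext φ
  have h₄ := LinearMap.congr_fun h₁ (v ⊗ₜ φ)
  rw [IsNilpotent.exp_add_of_commute hcomm hBL hDR, h₂, h₃] at h₄
  simpa using h₄

end Leibniz

namespace FermionModes

variable {F : Type} [AddCommGroup F] [Module ℂ F] (f : FermionModes F) {W : Finset ℤ}

/-- The quadratic operator `∑_{j,k} B_{jk} ψ_j ψ†_k`. -/
def secondQuant (B : Matrix W W ℂ) : Module.End ℂ F :=
  ∑ j : W, ∑ k : W, B j k • (f.psi j * f.psiDag k)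

lemma creation_single (j : W) : f.creation W (Pi.single j 1) = f.psi j := by
  simp [creation_apply, Pi.single_apply, ite_smul]

lemma annihilation_single (j : W) : f.annihilation W (Pi.single j 1) = f.psiDag j := by
  simp [annihilation_apply, Pi.single_apply, ite_smul]

lemma secondQuant_eq_row (B : Matrix W W ℂ) :
    f.secondQuant B = ∑ j : W, f.creation W (Pi.single j 1) * f.annihilation W (B j) := by
  simp only [secondQuant, creation_single, annihilation_apply, Finset.mul_sum, mul_smul_comm]

lemma secondQuant_eq_col (B : Matrix W W ℂ) :
    f.secondQuant B =
      ∑ k : W, f.creation W (fun j => B j k) * f.annihilation W (Pi.single k 1) := by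
  rw [secondQuant, Finset.sum_comm]
  simp only [annihilation_single, creation_apply, Finset.sum_mul, smul_mul_assoc]

lemma secondQuant_mul_creation (B : Matrix W W ℂ) (v : W → ℂ) :
    f.secondQuant B * f.creation W v =
      f.creation W (B.mulVecLin v) + f.creation W v * f.secondQuant B := by
  have hv : B.mulVecLin v = ∑ j : W, (B j ⬝ᵥ v) • (Pi.single j 1 : W → ℂ) := by
    ext i
    simp [Matrix.mulVec, Pi.single_apply, dotProduct]
  rw [hv, map_sum, secondQuant_eq_row, Finset.sum_mul, Finset.mul_sum, ← Finset.sum_add_distrib]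
  refine Finset.sum_congr rfl fun j _ => ?_
  rw [mul_assoc, f.annihilation_mul_creation, mul_sub, mul_smul_comm, mul_one, ← mul_assoc,
    f.creation_mul_creation, neg_mul, sub_neg_eq_add, map_smul, mul_assoc]

lemma secondQuant_mul_annihilation (B : Matrix W W ℂ) (w : W → ℂ) :
    f.secondQuant B * f.annihilation W w =
      f.annihilation W ((-B).transpose.mulVecLin w) + f.annihilation W w * f.secondQuant B := by
  have hw : (-B).transpose.mulVecLin w =
      ∑ k : W, (-(w ⬝ᵥ fun j => B j k)) • (Pi.single k 1 : W → ℂ) := by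
    ext i
    simp [Matrix.vecMul, Pi.single_apply, dotProduct, mul_comm]
  rw [hw, map_sum, secondQuant_eq_col, Finset.sum_mul, Finset.mul_sum, ← Finset.sum_add_distrib]
  refine Finset.sum_congr rfl fun k _ => ?_
  rw [mul_assoc, f.annihilation_mul_annihilation, mul_neg, ← mul_assoc,
    f.creation_mul_annihilation, sub_mul, smul_mul_assoc, one_mul, map_smul, mul_assoc, neg_sub,
    neg_smul]
  abel

lemma secondQuant_vac {B : Matrix W W ℂ} (hB : ∀ i j : W, j ≤ i → B i j = 0) :
    f.secondQuant B f.vac = 0 := by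
  rw [secondQuant, LinearMap.sum_apply]
  refine Finset.sum_eq_zero fun j _ => ?_
  rw [LinearMap.sum_apply]
  refine Finset.sum_eq_zero fun k _ => ?_
  rw [LinearMap.smul_apply]
  rcases le_or_gt k j with h | h
  · rw [hB j k h, zero_smul]
  · rcases le_or_gt 0 (k : ℤ) with hk | hk
    · rw [Module.End.mul_apply, f.psiDag_vac _ hk, map_zero, smul_zero]
    · have hjk : ((j : ℤ)) < k := h
      have := f.psi_psiDag j k
      rw [if_neg hjk.ne] at this
      rw [eq_neg_of_add_eq_zero_left this, LinearMap.neg_apply, Module.End.mul_apply,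
        f.psi_vac _ (hjk.trans hk), map_zero, neg_zero, smul_zero]

variable [Module ℚ F]

lemma exp_secondQuant_vac {B : Matrix W W ℂ} (hB : ∀ i j : W, j ≤ i → B i j = 0)
    (hD : IsNilpotent (f.secondQuant B)) :
    IsNilpotent.exp (f.secondQuant B) f.vac = f.vac := by
  obtain ⟨k, hk⟩ := hD
  have hk' : f.secondQuant B ^ (k + 1) = 0 := by rw [pow_succ, hk, zero_mul]
  rw [IsNilpotent.exp_eq_sum hk', Finset.sum_range_succ', LinearMap.add_apply, LinearMap.sum_apply,
    Finset.sum_eq_zero, zero_add]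
  · simp
  · intro i _
    rw [LinearMap.smul_apply, pow_succ, Module.End.mul_apply, f.secondQuant_vac hB, map_zero,
      smul_zero]

lemma exp_secondQuant_mul_creation {B : Matrix W W ℂ} (hB : IsNilpotent B)
    (hD : IsNilpotent (f.secondQuant B)) (v : W → ℂ) :
    IsNilpotent.exp (f.secondQuant B) * f.creation W v =
      f.creation W (Matrix.mulVec (IsNilpotent.exp B) v) *
        IsNilpotent.exp (f.secondQuant B) := by
  have h := exp_mul_of_leibniz (f.creation W) (B := Matrix.toLinAlgEquiv' B)
    (hB.map Matrix.toLinAlgEquiv') hD (f.secondQuant_mul_creation B) v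
  rwa [← hB.map_exp, Matrix.toLinAlgEquiv'_apply] at h

lemma exp_secondQuant_mul_annihilation {B : Matrix W W ℂ} (hB : IsNilpotent B)
    (hD : IsNilpotent (f.secondQuant B)) (w : W → ℂ) :
    IsNilpotent.exp (f.secondQuant B) * f.annihilation W w =
      f.annihilation W (Matrix.vecMul w (IsNilpotent.exp (-B))) *
        IsNilpotent.exp (f.secondQuant B) := by
  have hB' : IsNilpotent (-B).transpose := by
    obtain ⟨k, hk⟩ := hB.neg
    exact ⟨k, by rw [← Matrix.transpose_pow, hk, Matrix.transpose_zero]⟩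
  have h := exp_mul_of_leibniz (f.annihilation W) (B := Matrix.toLinAlgEquiv' (-B).transpose)
    (hB'.map Matrix.toLinAlgEquiv') hD (f.secondQuant_mul_annihilation B) w
  have he : IsNilpotent.exp (-B).transpose = (IsNilpotent.exp (-B)).transpose := by
    obtain ⟨k, hk⟩ := hB.neg
    have hk' : (-B).transpose ^ k = 0 := by rw [← Matrix.transpose_pow, hk, Matrix.transpose_zero]
    rw [IsNilpotent.exp_eq_sum hk, IsNilpotent.exp_eq_sum hk', Matrix.transpose_sum]
    simp only [Matrix.transpose_smul, Matrix.transpose_pow]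
  rwa [← hB'.map_exp, Matrix.toLinAlgEquiv'_apply, he, Matrix.mulVec_transpose] at h

/-- Conjugation moves the exponential of a strictly triangular quadratic operator through a product
of linear elements; the vacuum is invariant. -/
lemma exp_secondQuant_prod {B : Matrix W W ℂ} (hup : ∀ i j : W, j ≤ i → B i j = 0)
    (hB : IsNilpotent B) (hD : IsNilpotent (f.secondQuant B)) {n : ℕ} (w v : Fin n → W → ℂ) :
    IsNilpotent.exp (f.secondQuant B)
        ((List.ofFn fun a => f.annihilation W (w a) * f.creation W (v a)).prod f.vac) =
      (List.ofFn fun a => f.annihilation W (Matrix.vecMul (w a) (IsNilpotent.exp (-B))) *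
        f.creation W (Matrix.mulVec (IsNilpotent.exp B) (v a))).prod f.vac := by
  rw [← Module.End.mul_apply, mul_prod_ofFn_intertwine (X' := fun a =>
    f.annihilation W (Matrix.vecMul (w a) (IsNilpotent.exp (-B))) *
        f.creation W (Matrix.mulVec (IsNilpotent.exp B) (v a))), Module.End.mul_apply,
    f.exp_secondQuant_vac hup hD]
  intro a
  rw [← mul_assoc, f.exp_secondQuant_mul_annihilation hB hD, mul_assoc,
    f.exp_secondQuant_mul_creation hB hD, mul_assoc]

end FermionModes

/-! ### Truncation to a finite window -/

/-- The sites `-M ≤ k < M`. -/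
def window (M : ℕ) : Finset ℤ := Finset.Ico (-(M : ℤ)) M

lemma mem_window {M : ℕ} {k : ℤ} : k ∈ window M ↔ -(M : ℤ) ≤ k ∧ k < M := Finset.mem_Ico

/-- The truncation of a doubly infinite matrix to a window. -/
def trunc (M : ℕ) (A : Matrix ℤ ℤ ℂ) : Matrix (window M) (window M) ℂ :=
  A.submatrix (fun i => (i : ℤ)) fun i => (i : ℤ)

lemma trunc_upper {A : Matrix ℤ ℤ ℂ} (hA : StrictlyUpper A) (M : ℕ) (i j : window M)
    (h : j ≤ i) : trunc M A i j = 0 := hA _ _ h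

lemma StrictlyUpper.neg {A : Matrix ℤ ℤ ℂ} (hA : StrictlyUpper A) : StrictlyUpper (-A) := by
  intro i j h
  rw [Matrix.neg_apply, hA i j h, neg_zero]

lemma trunc_pow_apply {A : Matrix ℤ ℤ ℂ} (hA : StrictlyUpper A) (M m : ℕ) (i j : window M)
    (h : (j : ℤ) < i + m) : (trunc M A ^ m) i j = 0 := by
  induction m generalizing i with
  | zero =>
    rw [pow_zero, Matrix.one_apply_ne]
    rintro rfl
    simp at h
  | succ m ih =>
    rw [pow_succ', Matrix.mul_apply]
    refine Finset.sum_eq_zero fun k _ => ?_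
    rcases le_or_gt (k : ℤ) i with hk | hk
    · rw [trunc_upper hA M i k hk, zero_mul]
    · rw [ih k (by push_cast at h; omega), mul_zero]

lemma trunc_pow_eq_zero {A : Matrix ℤ ℤ ℂ} (hA : StrictlyUpper A) (M : ℕ) :
    trunc M A ^ (2 * M) = 0 := by
  ext i j
  have hi := mem_window.1 i.2
  have hj := mem_window.1 j.2
  exact trunc_pow_apply hA M _ i j (by push_cast; omega)

lemma trunc_isNilpotent {A : Matrix ℤ ℤ ℂ} (hA : StrictlyUpper A) (M : ℕ) :
    IsNilpotent (trunc M A) := ⟨_, trunc_pow_eq_zero hA M⟩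

lemma matPow_succ_apply (A : Matrix ℤ ℤ ℂ) (m : ℕ) (i j : ℤ) :
    matPow A (m + 1) i j = ∑ᶠ k : ℤ, A i k * matPow A m k j := rfl

lemma matPow_eq_zero {A : Matrix ℤ ℤ ℂ} (hA : StrictlyUpper A) (m : ℕ) (i j : ℤ)
    (h : j < i + m) : matPow A m i j = 0 := by
  induction m generalizing i with
  | zero =>
    rw [matPow, Matrix.one_apply_ne]
    rintro rfl
    simp at h
  | succ m ih =>
    rw [matPow]
    refine finsum_eq_zero_of_forall_eq_zero fun k => ?_
    rcases le_or_gt k i with hk | hk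
    · rw [hA i k hk, zero_mul]
    · rw [ih k (by push_cast at h; omega), mul_zero]

lemma matPow_eq_trunc_pow {A : Matrix ℤ ℤ ℂ} (hA : StrictlyUpper A) (M m : ℕ) (i j : window M) :
    matPow A m i j = (trunc M A ^ m) i j := by
  induction m generalizing i with
  | zero =>
    rw [matPow, pow_zero]
    rcases eq_or_ne i j with rfl | h
    · rw [Matrix.one_apply_eq, Matrix.one_apply_eq]
    · rw [Matrix.one_apply_ne h, Matrix.one_apply_ne (fun h' => h (Subtype.ext h'))]
  | succ m ih =>
    rw [matPow_succ_apply, pow_succ', Matrix.mul_apply, finsum_eq_sum_of_support_subset (s := window M),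
      ← Finset.sum_coe_sort]
    · exact Finset.sum_congr rfl fun k _ => by rw [ih k]; rfl
    · intro k hk
      have hi := mem_window.1 i.2
      have hj := mem_window.1 j.2
      have h1 : (i : ℤ) < k := by
        by_contra! h
        exact hk (by simp [hA _ _ h])
      have h2 : k ≤ j := by
        by_contra! h
        exact hk (by simp [matPow_eq_zero hA m k j (by omega)])
      exact mem_window.2 ⟨by omega, by omega⟩

lemma matExp_eq_zero {A : Matrix ℤ ℤ ℂ} (hA : StrictlyUpper A) {i j : ℤ} (h : j < i) :
    matExp A i j = 0 := by
  refine finsum_eq_zero_of_forall_eq_zero fun m => ?_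
  rw [matPow_eq_zero hA m i j (by omega), mul_zero]

lemma matExp_eq_exp_trunc {A : Matrix ℤ ℤ ℂ} (hA : StrictlyUpper A) (M : ℕ) (i j : window M) :
    matExp A i j = IsNilpotent.exp (trunc M A) i j := by
  rw [IsNilpotent.exp_eq_sum (trunc_pow_eq_zero hA M), matExp,
    finsum_eq_sum_of_support_subset (s := Finset.range (2 * M)), Matrix.sum_apply]
  · refine Finset.sum_congr rfl fun m _ => ?_
    rw [matPow_eq_trunc_pow hA M m i j, Matrix.smul_apply, Rat.smul_def]
    simp
  · intro m hm
    by_contra h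
    have hi := mem_window.1 i.2
    have hj := mem_window.1 j.2
    have hm' : 2 * M ≤ m := by simpa using h
    exact hm (by simp [matPow_eq_zero hA m i j (by omega)])

/-! ### Nilpotency: the energy decreases -/

/-- The total energy of the particles in a window. -/
def energy (M : ℕ) (S : Maya) : ℕ := ∑ k ∈ (window M).filter (· ∈ S.occ), (k + M).toNat

lemma energy_fill {M : ℕ} {S : Maya} {j : ℤ} (hj : j ∉ S.occ) (hM : j ∈ window M) :
    energy M (S.fill j) = (j + M).toNat + energy M S := by
  rw [energy, energy, ← Finset.sum_insert (f := fun k : ℤ => (k + (M : ℤ)).toNat) (by simp [hj])]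
  congr 1
  ext k
  simp only [Finset.mem_filter, Maya.mem_fill, Finset.mem_insert]
  grind

lemma energy_clear {M : ℕ} {S : Maya} {j : ℤ} (hj : j ∈ S.occ) (hM : j ∈ window M) :
    energy M S = (j + M).toNat + energy M (S.clear j) := by
  rw [← energy_fill (by simp) hM, Maya.fill_clear hj]

lemma psi_psiDag_ket_mem {M : ℕ} {j k : ℤ} (hjk : j < k) (hj : j ∈ window M) (hk : k ∈ window M)
    {S : Maya} {U : Submodule ℂ Fock}
    (hU : ∀ S', energy M S' < energy M S → ket S' ∈ U) :
    (psi j * psiDag k) (ket S) ∈ U := by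
  rw [Module.End.mul_apply, psiDag_ket]
  split_ifs with h
  · rw [map_smul, psi_ket]
    split_ifs with h'
    · simp
    · refine U.smul_mem _ (U.smul_mem _ (hU _ ?_))
      rw [energy_fill h' hj, energy_clear h hk]
      have := mem_window.1 hj
      omega
  · simp

lemma secondQuant_ket_mem {M : ℕ} {B : Matrix (window M) (window M) ℂ}
    (hB : ∀ i j, j ≤ i → B i j = 0) {S : Maya} {U : Submodule ℂ Fock}
    (hU : ∀ S', energy M S' < energy M S → ket S' ∈ U) :
    fockModes.secondQuant B (ket S) ∈ U := by
  rw [FermionModes.secondQuant, LinearMap.sum_apply]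
  refine U.sum_mem fun j _ => ?_
  rw [LinearMap.sum_apply]
  refine U.sum_mem fun k _ => ?_
  rw [LinearMap.smul_apply]
  rcases le_or_gt k j with h | h
  · rw [hB j k h, zero_smul]
    exact U.zero_mem
  · exact U.smul_mem _ (psi_psiDag_ket_mem h j.2 k.2 hU)

lemma secondQuant_isNilpotent {M : ℕ} {B : Matrix (window M) (window M) ℂ}
    (hB : ∀ i j, j ≤ i → B i j = 0) : IsNilpotent (fockModes.secondQuant B) := by
  have key : ∀ n S, energy M S < n → (fockModes.secondQuant B ^ n) (ket S) = 0 := by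
    intro n
    induction n with
    | zero => intro S h; omega
    | succ n ih =>
      intro S h
      rw [pow_succ, Module.End.mul_apply, ← LinearMap.mem_ker]
      exact secondQuant_ket_mem hB fun S' h' => LinearMap.mem_ker.2 (ih S' (by omega))
  refine ⟨(∑ k ∈ window M, (k + M).toNat) + 1, op_ext fun S => ?_⟩
  rw [key _ S, LinearMap.zero_apply]
  exact Nat.lt_succ_of_le (Finset.sum_le_sum_of_subset (Finset.filter_subset _ _))

/-! ### States that differ from the sea inside a window -/

/-- All sites below the window are occupied, all sites above it are empty. -/
def Maya.InWindow (M : ℕ) (S : Maya) : Prop :=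
  (∀ k < -(M : ℤ), k ∈ S.occ) ∧ ∀ k, (M : ℤ) ≤ k → k ∉ S.occ

/-- The span of the basis states that differ from the sea inside a window. -/
def windowSpace (M : ℕ) : Submodule ℂ Fock := Submodule.span ℂ {φ | ∃ S, S.InWindow M ∧ ket S = φ}

lemma Maya.InWindow.fill {M : ℕ} {S : Maya} (hS : S.InWindow M) {j : ℤ} (hj : j < M) :
    (S.fill j).InWindow M := by
  refine ⟨fun k hk => Maya.mem_fill.2 (Or.inr (hS.1 k hk)), fun k hk h => ?_⟩
  rcases Maya.mem_fill.1 h with rfl | h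
  · omega
  · exact hS.2 k hk h

lemma Maya.InWindow.clear {M : ℕ} {S : Maya} (hS : S.InWindow M) {j : ℤ} (hj : -(M : ℤ) ≤ j) :
    (S.clear j).InWindow M := by
  refine ⟨fun k hk => Maya.mem_clear.2 ⟨hS.1 k hk, by omega⟩, fun k hk h => ?_⟩
  exact hS.2 k hk (Maya.mem_clear.1 h).1

lemma Maya.InWindow.ket_mem {M : ℕ} {S : Maya} (hS : S.InWindow M) : ket S ∈ windowSpace M :=
  Submodule.subset_span ⟨S, hS, rfl⟩

lemma vac_mem_windowSpace (M : ℕ) : vac ∈ windowSpace M := by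
  refine Maya.InWindow.ket_mem ⟨fun k hk => ?_, fun k hk h => ?_⟩
  · rw [Maya.mem_sea]; omega
  · rw [Maya.mem_sea] at h; omega

lemma windowSpace_le_comap {M : ℕ} {T : Op}
    (h : ∀ S : Maya, S.InWindow M → T (ket S) ∈ windowSpace M) {φ : Fock}
    (hφ : φ ∈ windowSpace M) : T φ ∈ windowSpace M := by
  have : windowSpace M ≤ (windowSpace M).comap T := by
    refine Submodule.span_le.2 ?_
    rintro _ ⟨S, hS, rfl⟩
    exact h S hS
  exact this hφ

lemma psi_mem_windowSpace {M : ℕ} {j : ℤ} (hj : j ∈ window M) {φ : Fock}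
    (hφ : φ ∈ windowSpace M) : psi j φ ∈ windowSpace M := by
  refine windowSpace_le_comap (fun S hS => ?_) hφ
  rw [psi_ket]
  split_ifs
  · exact Submodule.zero_mem _
  · exact Submodule.smul_mem _ _ (hS.fill (mem_window.1 hj).2).ket_mem

lemma psiDag_mem_windowSpace {M : ℕ} {j : ℤ} (hj : j ∈ window M) {φ : Fock}
    (hφ : φ ∈ windowSpace M) : psiDag j φ ∈ windowSpace M := by
  refine windowSpace_le_comap (fun S hS => ?_) hφ
  rw [psiDag_ket]
  split_ifs
  · exact Submodule.smul_mem _ _ (hS.clear (mem_window.1 hj).1).ket_mem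
  · exact Submodule.zero_mem _

lemma creation_mem_windowSpace {M : ℕ} (v : window M → ℂ) {φ : Fock}
    (hφ : φ ∈ windowSpace M) : fockModes.creation (window M) v φ ∈ windowSpace M := by
  rw [FermionModes.creation_apply, LinearMap.sum_apply]
  exact Submodule.sum_mem _ fun k _ => Submodule.smul_mem _ _ (psi_mem_windowSpace k.2 hφ)

lemma annihilation_mem_windowSpace {M : ℕ} (v : window M → ℂ) {φ : Fock}
    (hφ : φ ∈ windowSpace M) : fockModes.annihilation (window M) v φ ∈ windowSpace M := by
  rw [FermionModes.annihilation_apply, LinearMap.sum_apply]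
  exact Submodule.sum_mem _ fun k _ => Submodule.smul_mem _ _ (psiDag_mem_windowSpace k.2 hφ)

lemma secondQuant_mem_windowSpace {M : ℕ} (B : Matrix (window M) (window M) ℂ) {φ : Fock}
    (hφ : φ ∈ windowSpace M) : fockModes.secondQuant B φ ∈ windowSpace M := by
  rw [FermionModes.secondQuant, LinearMap.sum_apply]
  refine Submodule.sum_mem _ fun j _ => ?_
  rw [LinearMap.sum_apply]
  exact Submodule.sum_mem _ fun k _ => Submodule.smul_mem _ _
    (psi_mem_windowSpace j.2 (psiDag_mem_windowSpace k.2 hφ))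

lemma prod_mem_windowSpace {M n : ℕ} (w v : Fin n → window M → ℂ) {φ : Fock}
    (hφ : φ ∈ windowSpace M) :
    (List.ofFn fun a => fockModes.annihilation (window M) (w a) *
      fockModes.creation (window M) (v a)).prod φ ∈ windowSpace M := by
  induction n with
  | zero => simpa using hφ
  | succ n ih =>
    rw [List.ofFn_succ, List.prod_cons, Module.End.mul_apply]
    exact annihilation_mem_windowSpace _ (creation_mem_windowSpace _ (ih _ _))

/-! ### Locally finite sums and exponentials on a window -/

lemma opSum_ket {ι : Type} (T : ι → Op) (S : Maya) : opSum T (ket S) = ∑ᶠ i, T i (ket S) := by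
  simp [opSum, ket, Finsupp.linearCombination_single]

lemma psi_psiDag_ket_eq_zero {M : ℕ} {S : Maya} (hS : S.InWindow M) {j k : ℤ} (hjk : j < k)
    (h : ¬(j ∈ window M ∧ k ∈ window M)) : psi j (psiDag k (ket S)) = 0 := by
  rw [psiDag_ket]
  split_ifs with hk
  · rw [map_smul, psi_ket, if_pos, smul_zero]
    have hkM : k < M := by
      by_contra! h'
      exact hS.2 k h' hk
    refine Maya.mem_clear.2 ⟨hS.1 j ?_, hjk.ne⟩
    simp only [mem_window] at h
    omega
  · simp

lemma vev_psi_psiDag {j k : ℤ} (hjk : j ≠ k) : vev (psi j * psiDag k) = 0 := by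
  rw [vev, Module.End.mul_apply]
  rcases le_or_gt 0 j with hj | hj
  · exact psi_apply_sea hj _
  · have := psi_psiDag_anticomm j k
    rw [if_neg hjk] at this
    have h2 := LinearMap.congr_fun this vac
    rw [LinearMap.add_apply, Module.End.mul_apply, Module.End.mul_apply, psi_vac hj, map_zero,
      add_zero] at h2
    rw [h2]
    rfl

lemma hatAlg_ket {A : Matrix ℤ ℤ ℂ} (hA : StrictlyUpper A) {M : ℕ} {S : Maya}
    (hS : S.InWindow M) : hatAlg A (ket S) = fockModes.secondQuant (trunc M A) (ket S) := by
  have h1 : ∀ p : ℤ × ℤ, (A p.1 p.2 • normalOrder (psi p.1) (psiDag p.2)) (ket S) =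
      A p.1 p.2 • psi p.1 (psiDag p.2 (ket S)) := by
    intro p
    rcases le_or_gt p.2 p.1 with h | h
    · simp [hA _ _ h]
    · rw [normalOrder, vev_psi_psiDag h.ne, zero_smul]
      simp
  rw [hatAlg, opSum_ket, finsum_congr h1,
    finsum_eq_sum_of_support_subset (s := window M ×ˢ window M), Finset.sum_product,
    ← Finset.sum_coe_sort, FermionModes.secondQuant, LinearMap.sum_apply]
  · refine Finset.sum_congr rfl fun j _ => ?_
    rw [← Finset.sum_coe_sort, LinearMap.sum_apply]
    rfl
  · rintro ⟨j, k⟩ h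
    have hjk : j < k := by
      by_contra! h'
      exact h (by simp [hA _ _ h'])
    by_contra h'
    refine h ?_
    dsimp only
    rw [psi_psiDag_ket_eq_zero hS hjk (by simpa using h'), smul_zero]

lemma opExp_eq_exp {M : ℕ} {T : Op} {B : Matrix (window M) (window M) ℂ}
    (hB : ∀ i j, j ≤ i → B i j = 0)
    (hT : ∀ S : Maya, S.InWindow M → T (ket S) = fockModes.secondQuant B (ket S)) {φ : Fock}
    (hφ : φ ∈ windowSpace M) :
    opExp T φ = IsNilpotent.exp (fockModes.secondQuant B) φ := by
  set D := fockModes.secondQuant B with hD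
  have hTD : ∀ φ ∈ windowSpace M, T φ = D φ := by
    intro φ hφ
    have : windowSpace M ≤ LinearMap.eqLocus T D := by
      refine Submodule.span_le.2 ?_
      rintro _ ⟨S, hS, rfl⟩
      exact hT S hS
    exact this hφ
  have hpow : ∀ m, ∀ φ ∈ windowSpace M, (T ^ m) φ = (D ^ m) φ := by
    intro m
    induction m with
    | zero => intro φ _; simp
    | succ m ih =>
      intro φ hφ
      rw [pow_succ, pow_succ, Module.End.mul_apply, Module.End.mul_apply, hTD φ hφ]
      exact ih _ (secondQuant_mem_windowSpace B hφ)
  obtain ⟨N, hN⟩ := secondQuant_isNilpotent hB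
  have : windowSpace M ≤ LinearMap.eqLocus (opExp T) (IsNilpotent.exp D) := by
    refine Submodule.span_le.2 ?_
    rintro _ ⟨S, hS, rfl⟩
    change opExp T (ket S) = IsNilpotent.exp D (ket S)
    rw [opExp, opSum_ket, IsNilpotent.exp_eq_sum hN,
      finsum_eq_sum_of_support_subset (s := Finset.range N), LinearMap.sum_apply]
    · refine Finset.sum_congr rfl fun m _ => ?_
      rw [LinearMap.smul_apply, LinearMap.smul_apply, hpow m _ hS.ket_mem]
      ext S'
      simp [Rat.smul_def]
    · intro m hm
      by_contra h
      have hm' : N ≤ m := by simpa using h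
      refine hm ?_
      simp only [LinearMap.smul_apply]
      rw [hpow m _ hS.ket_mem, pow_eq_zero_of_le hm' hN, LinearMap.zero_apply, smul_zero]
  exact this hφ

lemma hatG_eq_exp {A : Matrix ℤ ℤ ℂ} (hA : StrictlyUpper A) {M : ℕ} {φ : Fock}
    (hφ : φ ∈ windowSpace M) :
    hatG A φ = IsNilpotent.exp (fockModes.secondQuant (trunc M A)) φ :=
  opExp_eq_exp (trunc_upper hA M) (fun _ hS => hatAlg_ket hA hS) hφ

/-- The upper triangular Toeplitz matrix of the shift flows. -/
def toeplitz (t : ℕ+ → ℂ) : Matrix ℤ ℤ ℂ := Matrix.of fun i j =>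
  if i < j then t (j - i).toNat.toPNat' else 0

lemma toeplitz_strictlyUpper (t : ℕ+ → ℂ) : StrictlyUpper (toeplitz t) := fun _ _ h =>
  if_neg (not_lt.2 h)

lemma toeplitz_add (t : ℕ+ → ℂ) (k : ℤ) (j : ℕ+) : toeplitz t k (k + ((j : ℕ) : ℤ)) = t j := by
  rw [toeplitz, Matrix.of_apply, if_pos (by simp)]
  congr 1
  apply PNat.eq
  simp

lemma toeplitz_neg (t : ℕ+ → ℂ) : toeplitz (-t) = -toeplitz t := by
  ext i j
  simp only [toeplitz, Matrix.neg_apply, Matrix.of_apply, Pi.neg_apply]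
  split_ifs <;> simp

lemma finsum_comp_add_pnat {E : Type} [AddCommMonoid E] (g : ℤ → E) (k : ℤ)
    (hg : ∀ l ≤ k, g l = 0) : ∑ᶠ j : ℕ+, g (k + ((j : ℕ) : ℤ)) = ∑ᶠ l, g l := by
  have hinj : Function.Injective fun j : ℕ+ => k + ((j : ℕ) : ℤ) := by
    intro a b h
    apply PNat.eq
    simpa using h
  rw [← finsum_mem_range (f := g) hinj]
  refine finsum_congr fun l => ?_
  rcases le_or_gt l k with h | h
  · rw [hg l h]
    simp
  · refine finsum_eq_if.trans ?_
    rw [if_pos]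
    refine ⟨⟨(l - k).toNat, by omega⟩, ?_⟩
    simp
    omega

lemma opSum_current_ket (t : ℕ+ → ℂ) {M : ℕ} {S : Maya} (hS : S.InWindow M) :
    opSum (fun j : ℕ+ => t j • current j) (ket S) =
      fockModes.secondQuant (trunc M (toeplitz t)) (ket S) := by
  have hcur : ∀ j : ℕ+, current j (ket S) =
      ∑ k ∈ window M, psi k (psiDag (k + ((j : ℕ) : ℤ)) (ket S)) := by
    intro j
    rw [current, opSum_ket, finsum_eq_sum_of_support_subset (s := window M)]
    · rfl
    · intro k hk
      by_contra h
      refine hk ?_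
      dsimp only
      rw [Module.End.mul_apply]
      exact psi_psiDag_ket_eq_zero hS (by simp) fun h' => h h'.1
  have hterm : ∀ j : ℕ+, (t j • current j) (ket S) =
      ∑ k ∈ window M, t j • psi k (psiDag (k + ((j : ℕ) : ℤ)) (ket S)) := by
    intro j
    rw [LinearMap.smul_apply, hcur, Finset.smul_sum]
  have hfin : ∀ k ∈ window M, (Function.support fun j : ℕ+ =>
      t j • psi k (psiDag (k + ((j : ℕ) : ℤ)) (ket S))).Finite := by
    intro k _
    refine Set.Finite.subset (s := {j : ℕ+ | (j : ℕ) ≤ 2 * M}) ?_ ?_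
    · exact Set.Finite.preimage (f := fun j : ℕ+ => (j : ℕ)) PNat.coe_injective.injOn
        (Set.finite_Iic (2 * M))
    · intro j hj
      change (j : ℕ) ≤ 2 * M
      by_contra! h
      refine hj ?_
      dsimp only
      rw [psi_psiDag_ket_eq_zero hS (by simp), smul_zero]
      simp only [mem_window]
      omega
  rw [opSum_ket, finsum_congr hterm, finsum_sum_comm _ _ hfin, ← Finset.sum_coe_sort,
    FermionModes.secondQuant, LinearMap.sum_apply]
  refine Finset.sum_congr rfl fun k _ => ?_
  have h1 : ∀ j : ℕ+, t j • psi k (psiDag (k + ((j : ℕ) : ℤ)) (ket S)) =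
      (fun l : ℤ => toeplitz t k l • psi k (psiDag l (ket S))) (k + ((j : ℕ) : ℤ)) := by
    intro j
    simp only [toeplitz_add]
  rw [finsum_congr h1,
    finsum_comp_add_pnat (fun l : ℤ => toeplitz t k l • psi k (psiDag l (ket S))) k fun l hl => by
      rw [toeplitz_strictlyUpper t _ _ hl, zero_smul],
    finsum_eq_sum_of_support_subset (s := window M), LinearMap.sum_apply, ← Finset.sum_coe_sort]
  · rfl
  · intro l hl
    have hkl : (k : ℤ) < l := by
      by_contra! h
      exact hl (by simp [toeplitz_strictlyUpper t _ _ h])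
    by_contra h
    exact hl (by
      dsimp only
      rw [psi_psiDag_ket_eq_zero hS hkl fun h' => h h'.2, smul_zero])

lemma hatGamma_eq_exp (t : ℕ+ → ℂ) {M : ℕ} {φ : Fock} (hφ : φ ∈ windowSpace M) :
    hatGamma t φ = IsNilpotent.exp (fockModes.secondQuant (trunc M (toeplitz t))) φ :=
  opExp_eq_exp (trunc_upper (toeplitz_strictlyUpper t) M) (fun _ hS => opSum_current_ket t hS) hφ

/-! ### The partition state in the window -/

/-- The coefficient vector of a single site. -/
def siteVec (M : ℕ) (k : ℤ) : window M → ℂ := fun i => if (i : ℤ) = k then 1 else 0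

lemma siteVec_eq_single {M : ℕ} (k : window M) : siteVec M k = Pi.single k 1 := by
  ext i
  rw [siteVec, Pi.single_apply]
  exact if_congr Subtype.ext_iff.symm rfl rfl

lemma creation_siteVec {F : Type} [AddCommGroup F] [Module ℂ F] (f : FermionModes F) {M : ℕ}
    {k : ℤ} (hk : k ∈ window M) : f.creation (window M) (siteVec M k) = f.psi k := by
  rw [siteVec_eq_single ⟨k, hk⟩, f.creation_single]

lemma annihilation_siteVec {F : Type} [AddCommGroup F] [Module ℂ F] (f : FermionModes F) {M : ℕ}
    {k : ℤ} (hk : k ∈ window M) : f.annihilation (window M) (siteVec M k) = f.psiDag k := by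
  rw [siteVec_eq_single ⟨k, hk⟩, f.annihilation_single]

lemma siteVec_dotProduct {M : ℕ} {k : ℤ} (hk : k ∈ window M) (v : window M → ℂ) :
    siteVec M k ⬝ᵥ v = v ⟨k, hk⟩ := by
  rw [siteVec_eq_single ⟨k, hk⟩]
  simp

lemma dotProduct_siteVec {M : ℕ} {k : ℤ} (hk : k ∈ window M) (v : window M → ℂ) :
    v ⬝ᵥ siteVec M k = v ⟨k, hk⟩ := by
  rw [siteVec_eq_single ⟨k, hk⟩]
  simp

lemma smul_prod_ofFn {R : Type*} [Ring R] [Algebra ℂ R] {n : ℕ} (c : Fin n → ℂ) (X : Fin n → R) :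
    (∏ j, c j) • (List.ofFn X).prod = (List.ofFn fun j => c j • X j).prod := by
  induction n with
  | zero => simp
  | succ n ih =>
    rw [Fin.prod_univ_succ, List.ofFn_succ, List.ofFn_succ, List.prod_cons, List.prod_cons, ← ih,
      smul_mul_smul_comm]

/-- The window contains all sites that occur in `|λ⟩`. -/
def Covers (M : ℕ) (lam : YoungDiagram) : Prop := ∀ j, arm lam j < M ∧ leg lam j < M

lemma exists_covers (lam : YoungDiagram) : ∃ M₀, ∀ M, M₀ ≤ M → Covers M lam := by
  refine ⟨∑ j, (arm lam j + leg lam j) + 1, fun M hM j => ?_⟩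
  have := Finset.single_le_sum (f := fun j => arm lam j + leg lam j) (fun _ _ => Nat.zero_le _)
    (Finset.mem_univ j)
  omega

lemma Covers.arm_mem {M : ℕ} {lam : YoungDiagram} (h : Covers M lam) (j : Fin (frobRank lam)) :
    (arm lam j : ℤ) ∈ window M := by
  have := h j
  exact mem_window.2 ⟨by omega, by omega⟩

lemma Covers.leg_mem {M : ℕ} {lam : YoungDiagram} (h : Covers M lam) (j : Fin (frobRank lam)) :
    -(leg lam j : ℤ) - 1 ∈ window M := by
  have := h j
  exact mem_window.2 ⟨by omega, by omega⟩

lemma FermionModes.partition_prod {F : Type} [AddCommGroup F] [Module ℂ F] (f : FermionModes F)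
    {M : ℕ} {lam : YoungDiagram} (h : Covers M lam) :
    (-1 : ℂ) ^ (∑ j, leg lam j) •
      (List.ofFn fun j => f.psi (arm lam j : ℤ) * f.psiDag (-(leg lam j : ℤ) - 1)).prod =
    (List.ofFn fun j => f.annihilation (window M)
        ((-1 : ℂ) ^ (leg lam j + 1) • siteVec M (-(leg lam j : ℤ) - 1)) *
      f.creation (window M) (siteVec M (arm lam j))).prod := by
  rw [← Finset.prod_pow_eq_pow_sum, smul_prod_ofFn]
  congr 2
  ext1 j
  have h1 := f.psi_psiDag (arm lam j : ℤ) (-(leg lam j : ℤ) - 1)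
  rw [if_neg (by omega)] at h1
  rw [map_smul, creation_siteVec f (h.arm_mem j), annihilation_siteVec f (h.leg_mem j),
    eq_neg_of_add_eq_zero_left h1, pow_succ, smul_mul_assoc, mul_neg_one, neg_smul, smul_neg]

lemma ketPartition_eq {M : ℕ} {lam : YoungDiagram} (h : Covers M lam) :
    ketPartition lam = (List.ofFn fun j => fockModes.annihilation (window M)
        ((-1 : ℂ) ^ (leg lam j + 1) • siteVec M (-(leg lam j : ℤ) - 1)) *
      fockModes.creation (window M) (siteVec M (arm lam j))).prod vac := by
  rw [← fockModes.partition_prod h]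
  rfl

/-- The coefficients of the annihilation operators in `ĝ(A)|λ⟩`. -/
def stateRow (A : Matrix ℤ ℤ ℂ) (lam : YoungDiagram) (M : ℕ) (i : Fin (frobRank lam)) :
    window M → ℂ := fun k => (-1 : ℂ) ^ (leg lam i + 1) * matExp (-A) (-(leg lam i : ℤ) - 1) k

/-- The coefficients of the creation operators in `ĝ(A)|λ⟩`. -/
def stateCol (A : Matrix ℤ ℤ ℂ) (lam : YoungDiagram) (M : ℕ) (j : Fin (frobRank lam)) :
    window M → ℂ := fun k => matExp A k (arm lam j)

lemma vecMul_siteVec {A : Matrix ℤ ℤ ℂ} (hA : StrictlyUpper A) {M : ℕ} {lam : YoungDiagram}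
    (h : Covers M lam) (i : Fin (frobRank lam)) :
    Matrix.vecMul ((-1 : ℂ) ^ (leg lam i + 1) • siteVec M (-(leg lam i : ℤ) - 1))
      (IsNilpotent.exp (-trunc M A)) = stateRow A lam M i := by
  ext k
  rw [Matrix.vecMul, smul_dotProduct, siteVec_dotProduct (h.leg_mem i), stateRow, smul_eq_mul,
    show -trunc M A = trunc M (-A) from rfl,
    ← matExp_eq_exp_trunc hA.neg M ⟨_, h.leg_mem i⟩ k]

lemma mulVec_siteVec {A : Matrix ℤ ℤ ℂ} (hA : StrictlyUpper A) {M : ℕ} {lam : YoungDiagram}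
    (h : Covers M lam) (j : Fin (frobRank lam)) :
    Matrix.mulVec (IsNilpotent.exp (trunc M A)) (siteVec M (arm lam j)) = stateCol A lam M j := by
  ext k
  rw [Matrix.mulVec, dotProduct_siteVec (h.arm_mem j), stateCol,
    ← matExp_eq_exp_trunc hA M k ⟨_, h.arm_mem j⟩]

lemma hatG_ketPartition {A : Matrix ℤ ℤ ℂ} (hA : StrictlyUpper A) {M : ℕ} {lam : YoungDiagram}
    (h : Covers M lam) :
    hatG A (ketPartition lam) = (List.ofFn fun j =>
      fockModes.annihilation (window M) (stateRow A lam M j) *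
        fockModes.creation (window M) (stateCol A lam M j)).prod vac := by
  rw [ketPartition_eq h, hatG_eq_exp hA (prod_mem_windowSpace _ _ (vac_mem_windowSpace M))]
  refine (fockModes.exp_secondQuant_prod (trunc_upper hA M) (trunc_isNilpotent hA M)
    (secondQuant_isNilpotent (trunc_upper hA M)) _ _).trans ?_
  simp only [vecMul_siteVec hA h, mulVec_siteVec hA h]
  rfl

lemma stateRow_dotProduct_stateCol {A : Matrix ℤ ℤ ℂ} (hA : StrictlyUpper A) {M : ℕ}
    {lam : YoungDiagram} (h : Covers M lam) (i j : Fin (frobRank lam)) :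
    stateRow A lam M i ⬝ᵥ stateCol A lam M j = 0 := by
  rw [← vecMul_siteVec hA h, ← mulVec_siteVec hA h, ← Matrix.dotProduct_mulVec,
    Matrix.mulVec_mulVec, IsNilpotent.exp_neg_mul_exp_self (trunc_isNilpotent hA M),
    Matrix.one_mulVec, smul_dotProduct, siteVec_dotProduct (h.leg_mem i), siteVec,
    if_neg (by dsimp only; omega), smul_zero]

/-! ### The tau function as a determinant -/

/-- The coefficient vectors after the flow `γ̂₊(t)`. -/
def flowRow (A : Matrix ℤ ℤ ℂ) (lam : YoungDiagram) (M : ℕ) (t : ℕ+ → ℂ)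
    (i : Fin (frobRank lam)) : window M → ℂ :=
  Matrix.vecMul (stateRow A lam M i) (IsNilpotent.exp (-trunc M (toeplitz t)))

/-- The coefficient vectors after the flow `γ̂₊(t)`. -/
def flowCol (A : Matrix ℤ ℤ ℂ) (lam : YoungDiagram) (M : ℕ) (t : ℕ+ → ℂ)
    (j : Fin (frobRank lam)) : window M → ℂ :=
  Matrix.mulVec (IsNilpotent.exp (trunc M (toeplitz t))) (stateCol A lam M j)

lemma wickMatrix_of_orthogonal {W : Finset ℤ} {n : ℕ} {w v : Fin n → W → ℂ}
    (h : ∀ i j, w i ⬝ᵥ v j = 0) :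
    wickMatrix w v = Matrix.of fun i j => nonnegPart (w i) ⬝ᵥ v j := by
  ext i j
  have := nonnegPart_dotProduct_add_negPart_dotProduct (w i) (v j)
  rw [h i j] at this
  simp only [wickMatrix, Matrix.of_apply]
  split_ifs
  · rfl
  · exact (eq_neg_of_add_eq_zero_left this).symm

lemma tau_eq_det {A : Matrix ℤ ℤ ℂ} (hA : StrictlyUpper A) {M : ℕ} {lam : YoungDiagram}
    (h : Covers M lam) (t : ℕ+ → ℂ) :
    tau A lam t =
      (Matrix.of fun i j => nonnegPart (flowRow A lam M t i) ⬝ᵥ flowCol A lam M t j).det := by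
  have hT := toeplitz_strictlyUpper t
  rw [← wickMatrix_of_orthogonal, ← fockModes.wick, tau, hatG_ketPartition hA h,
    hatGamma_eq_exp t (prod_mem_windowSpace _ _ (vac_mem_windowSpace M))]
  · exact congrArg (fun φ : Fock => φ Maya.sea)
      (fockModes.exp_secondQuant_prod (trunc_upper hT M) (trunc_isNilpotent hT M)
        (secondQuant_isNilpotent (trunc_upper hT M)) _ _)
  · intro i j
    rw [flowRow, flowCol, ← Matrix.dotProduct_mulVec, Matrix.mulVec_mulVec,
      IsNilpotent.exp_neg_mul_exp_self (trunc_isNilpotent hT M), Matrix.one_mulVec,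
      stateRow_dotProduct_stateCol hA h]

/-! ### Sums over the window -/

lemma sum_window_nonneg (M : ℕ) (g : ℤ → ℂ) :
    (∑ k : window M, if 0 ≤ (k : ℤ) then g k else 0) = ∑ k ∈ Finset.range M, g k := by
  rw [Finset.sum_coe_sort (window M) fun k : ℤ => if 0 ≤ k then g k else 0, ← Finset.sum_filter]
  symm
  refine Finset.sum_bij (fun k _ => (k : ℤ)) ?_ ?_ ?_ ?_
  · intro k hk
    simp only [Finset.mem_range] at hk
    simp only [Finset.mem_filter, mem_window]
    omega
  · intro a _ b _ hab
    exact_mod_cast hab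
  · intro k hk
    simp only [Finset.mem_filter, mem_window] at hk
    exact ⟨k.toNat, by simp only [Finset.mem_range]; omega, by omega⟩
  · intro k _
    rfl

lemma sum_window_neg (M : ℕ) (g : ℤ → ℂ) :
    (∑ k : window M, if 0 ≤ (k : ℤ) then 0 else g k) =
      ∑ k ∈ Finset.range M, g (-(k : ℤ) - 1) := by
  rw [Finset.sum_coe_sort (window M) fun k : ℤ => if 0 ≤ k then 0 else g k]
  simp only [← ite_not (p := (0 : ℤ) ≤ _)]
  rw [← Finset.sum_filter]
  symm
  refine Finset.sum_bij (fun k _ => -(k : ℤ) - 1) ?_ ?_ ?_ ?_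
  · intro k hk
    simp only [Finset.mem_range] at hk
    simp only [Finset.mem_filter, mem_window]
    omega
  · intro a _ b _ hab
    omega
  · intro k hk
    simp only [Finset.mem_filter, mem_window] at hk
    exact ⟨(-k - 1).toNat, by simp only [Finset.mem_range]; omega, by omega⟩
  · intro k _
    rfl

lemma sum_range_eq_of_eq_zero {N M : ℕ} (h : N ≤ M) {g : ℕ → ℂ} (hg : ∀ k, N ≤ k → g k = 0) :
    ∑ k ∈ Finset.range M, g k = ∑ k ∈ Finset.range N, g k := by
  symm
  refine Finset.sum_subset (Finset.range_mono h) fun k _ hk => hg k ?_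
  simpa using hk

lemma nonnegPart_stateRow_dotProduct {A : Matrix ℤ ℤ ℂ} (hA : StrictlyUpper A) {M : ℕ}
    {lam : YoungDiagram} (h : Covers M lam) (i j : Fin (frobRank lam)) :
    nonnegPart (stateRow A lam M i) ⬝ᵥ stateCol A lam M j = blockG A lam i j := by
  have h0 := nonnegPart_dotProduct_add_negPart_dotProduct (stateRow A lam M i) (stateCol A lam M j)
  rw [stateRow_dotProduct_stateCol hA h] at h0
  rw [eq_neg_of_add_eq_zero_left h0, negPart_dotProduct_eq]
  simp only [stateRow, stateCol]
  rw [sum_window_neg M fun k => (-1 : ℂ) ^ (leg lam i + 1) *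
    matExp (-A) (-(leg lam i : ℤ) - 1) k * matExp A k (arm lam j),
    sum_range_eq_of_eq_zero (N := leg lam i + 1) (h i).2, blockG, Finset.mul_sum,
    ← Finset.sum_neg_distrib]
  · refine Finset.sum_congr rfl fun k _ => ?_
    rw [coeffP, coeffPStar]
    ring
  · intro k hk
    rw [matExp_eq_zero hA.neg (by omega)]
    simp

/-! ### Summation of determinants of mode expansions -/

lemma hasSum_mul_prod {β γ : Type} {f : β → ℂ} {g : γ → ℂ} {a b : ℂ} (hf : HasSum f a)
    (hg : HasSum g b) : HasSum (fun p : β × γ => f p.1 * g p.2) (a * b) := by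
  have h1 := summable_norm_iff.2 hf.summable
  have h2 := summable_norm_iff.2 hg.summable
  exact hf.mul hg (summable_mul_of_summable_norm (R := ℂ) h1 h2)

lemma hasSum_fin_prod {β : Type} {n : ℕ} (f : Fin n → β → ℂ) (s : Fin n → ℂ)
    (hf : ∀ i, HasSum (f i) (s i)) :
    HasSum (fun m : Fin n → β => ∏ i, f i (m i)) (∏ i, s i) := by
  induction n with
  | zero =>
    rw [Fin.prod_univ_zero]
    simp only [Fin.prod_univ_zero]
    exact hasSum_unique fun _ : Fin 0 → β => (1 : ℂ)
  | succ n ih =>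
    rw [Fin.prod_univ_succ]
    have h := ih (fun i => f i.succ) (fun i => s i.succ) fun i => hf i.succ
    have := hasSum_mul_prod (hf 0) h
    refine ((Fin.consEquiv fun _ : Fin (n + 1) => β).hasSum_iff
      (f := fun m : Fin (n + 1) → β => ∏ i, f i (m i))).1 (this.congr_fun fun p => ?_)
    simp [Fin.prod_univ_succ, Fin.consEquiv]

lemma hasSum_pi_prod {ι β : Type} [Fintype ι] (f : ι → β → ℂ) (s : ι → ℂ)
    (hf : ∀ i, HasSum (f i) (s i)) :
    HasSum (fun m : ι → β => ∏ i, f i (m i)) (∏ i, s i) := by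
  let e := Fintype.equivFin ι
  have := hasSum_fin_prod (fun i => f (e.symm i)) (fun i => s (e.symm i)) fun i => hf _
  rw [Equiv.prod_comp e.symm s] at this
  refine ((Equiv.arrowCongr e.symm (Equiv.refl β)).hasSum_iff
    (f := fun m : ι → β => ∏ i, f i (m i))).1 (this.congr_fun fun m => ?_)
  simp only [Function.comp_apply]
  rw [← Equiv.prod_comp e.symm]
  simp

/-- Permutation of the second components of a family of pairs. -/
def permSnd {ι : Type} (σ : Equiv.Perm ι) : (ι → ℤ × ℤ) ≃ (ι → ℤ × ℤ) where
  toFun kl q := ((kl (σ q)).1, (kl q).2)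
  invFun kl q := ((kl (σ⁻¹ q)).1, (kl q).2)
  left_inv kl := by ext q <;> simp
  right_inv kl := by ext q <;> simp

theorem hasSum_det {ι : Type} [Fintype ι] [DecidableEq ι] (E : ι → ι → ℤ → ℤ → ℂ) (S : Matrix ι ι ℂ)
    (hE : ∀ p q, HasSum (fun kl : ℤ × ℤ => E p q kl.1 kl.2) (S p q)) :
    HasSum (fun kl : ι → ℤ × ℤ => (Matrix.of fun p q => E p q (kl p).1 (kl q).2).det) S.det := by
  simp only [Matrix.det_apply, Matrix.of_apply]
  refine hasSum_sum fun σ _ => ?_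
  have h := hasSum_pi_prod (fun q (kl : ℤ × ℤ) => E (σ q) q kl.1 kl.2) _ fun q => hE (σ q) q
  rw [← (permSnd σ).hasSum_iff] at h
  exact h.const_smul _

/-! ### The correlator -/

section Correlator

variable (A : Matrix ℤ ℤ ℂ) (lam : YoungDiagram) {n : ℕ} (x y : Fin n → ℂ)

/-- The mode expansion of the entries of the block matrix. Summation indices of rows and columns
that carry no field are fixed at `0`. -/
def modeEntry : Fin n ⊕ Fin (frobRank lam) → Fin n ⊕ Fin (frobRank lam) → ℤ → ℤ → ℂ
  | .inl a, .inl b => fun k l => if k = l then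
      x a ^ (k + 1) * y b ^ (-l) * (if a ≤ b then if 0 ≤ k then 1 else 0
        else if 0 ≤ k then 0 else -1) else 0
  | .inl a, .inr j => fun k l => if l = 0 then
      (if 0 ≤ k then x a ^ (k + 1) * coeffP A k (arm lam j) else 0) else 0
  | .inr i, .inl b => fun k l => if k = 0 then
      (if 0 ≤ l then 0 else
        (-1) ^ leg lam i * coeffPStar A (leg lam i) (-l - 1) * y b ^ (-l)) else 0
  | .inr i, .inr j => fun k l => if k = 0 then if l = 0 then blockG A lam i j else 0 else 0

/-- The extension of a family of modes by `0`. -/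
def extendModes (m : Fin n → ℤ × ℤ) : Fin n ⊕ Fin (frobRank lam) → ℤ × ℤ :=
  Sum.elim m fun _ => (0, 0)

@[simp] lemma extendModes_inl (m : Fin n → ℤ × ℤ) (a : Fin n) :
    extendModes lam m (Sum.inl a) = m a := rfl

@[simp] lemma extendModes_inr (m : Fin n → ℤ × ℤ) (i : Fin (frobRank lam)) :
    extendModes lam m (Sum.inr i) = (0, 0) := rfl

lemma extendModes_injective : Function.Injective (extendModes lam (n := n)) := fun _ _ h =>
  funext fun a => congrFun h (Sum.inl a)

lemma det_modeEntry_eq_zero {kl : Fin n ⊕ Fin (frobRank lam) → ℤ × ℤ}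
    (h : kl ∉ Set.range (extendModes lam (n := n))) :
    (Matrix.of fun p q => modeEntry A lam x y p q (kl p).1 (kl q).2).det = 0 := by
  have : ∃ i, kl (Sum.inr i) ≠ (0, 0) := by
    by_contra! h'
    refine h ⟨fun a => kl (Sum.inl a), ?_⟩
    ext1 p
    rcases p with a | i
    · rfl
    · exact (h' i).symm
  obtain ⟨i, hi⟩ := this
  by_cases h1 : (kl (Sum.inr i)).1 = 0
  · have h2 : (kl (Sum.inr i)).2 ≠ 0 := fun h2 => hi (Prod.ext h1 h2)
    refine Matrix.det_eq_zero_of_column_eq_zero (Sum.inr i) fun p => ?_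
    rcases p with a | j <;> simp [modeEntry, h2]
  · refine Matrix.det_eq_zero_of_row_eq_zero (Sum.inr i) fun p => ?_
    rcases p with a | j <;> simp [modeEntry, h1]

lemma nonnegPart_siteVec_dotProduct {M : ℕ} {k : ℤ} (hk : k ∈ window M) (v : window M → ℂ) :
    nonnegPart (siteVec M k) ⬝ᵥ v = if 0 ≤ k then v ⟨k, hk⟩ else 0 := by
  have : nonnegPart (siteVec M k) = (if 0 ≤ k then (1 : ℂ) else 0) • siteVec M k := by
    ext i
    simp only [nonnegPart, siteVec, Pi.smul_apply, smul_eq_mul]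
    by_cases h : (i : ℤ) = k
    · rw [h]; simp
    · simp [h]
  rw [this, smul_dotProduct, siteVec_dotProduct hk]
  split_ifs <;> simp

lemma negPart_dotProduct_siteVec {M : ℕ} {k : ℤ} (hk : k ∈ window M) (w : window M → ℂ) :
    negPart w ⬝ᵥ siteVec M k = if 0 ≤ k then 0 else w ⟨k, hk⟩ := by
  rw [dotProduct_siteVec hk, negPart]

lemma stateCol_apply (M : ℕ) (j : Fin (frobRank lam)) (k : window M) :
    stateCol A lam M j k = coeffP A k (arm lam j) := rfl

lemma stateRow_apply (M : ℕ) (i : Fin (frobRank lam)) (k : window M) :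
    stateRow A lam M i k =
      (-1 : ℂ) ^ (leg lam i + 1) * coeffPStar A (leg lam i) (-(k : ℤ) - 1) := by
  rw [stateRow, coeffPStar]
  congr 2
  ring

lemma psiDagCoeff_inv (z : ℂ) (k : ℤ) : psiDagCoeff z⁻¹ k = z ^ (k + 1) := by
  rw [psiDagCoeff, inv_zpow, ← zpow_neg]
  congr 1
  ring

lemma psiCoeff_inv (z : ℂ) (k : ℤ) : psiCoeff z⁻¹ k = z ^ (-k) := by
  rw [psiCoeff, inv_zpow, ← zpow_neg]

variable {A lam x y}

lemma correlatorTerm_eq_det (hA : StrictlyUpper A) (m : Fin n → ℤ × ℤ) :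
    correlatorTerm A lam x y m = (Matrix.of fun p q => modeEntry A lam x y p q
      (extendModes lam m p).1 (extendModes lam m q).2).det := by
  obtain ⟨M₀, hM₀⟩ := exists_covers lam
  set M := M₀ + ∑ a, ((m a).1.natAbs + (m a).2.natAbs) + 1 with hM
  have hcov : Covers M lam := hM₀ M (by omega)
  have hbound : ∀ a, (m a).1.natAbs + (m a).2.natAbs ≤
      ∑ a, ((m a).1.natAbs + (m a).2.natAbs) := fun a =>
    Finset.single_le_sum (f := fun a => (m a).1.natAbs + (m a).2.natAbs)
      (fun _ _ => Nat.zero_le _) (Finset.mem_univ a)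
  have h1 : ∀ a, (m a).1 ∈ window M := fun a => by
    have := hbound a
    exact mem_window.2 ⟨by omega, by omega⟩
  have h2 : ∀ a, (m a).2 ∈ window M := fun a => by
    have := hbound a
    exact mem_window.2 ⟨by omega, by omega⟩
  set w : Fin (n + frobRank lam) → window M → ℂ :=
    Fin.append (fun a => siteVec M (m a).1) (stateRow A lam M) with hw
  set v : Fin (n + frobRank lam) → window M → ℂ :=
    Fin.append (fun a => siteVec M (m a).2) (stateCol A lam M) with hv
  have hvev : (List.ofFn fun a => psiDag (m a).1 * psi (m a).2).prod
      (hatG A (ketPartition lam)) Maya.sea = (wickMatrix w v).det := by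
    rw [← fockModes.wick, hatG_ketPartition hA hcov]
    have happ : (fun a => fockModes.annihilation (window M) (w a) *
        fockModes.creation (window M) (v a)) =
        Fin.append (fun a => psiDag (m a).1 * psi (m a).2) fun j =>
          fockModes.annihilation (window M) (stateRow A lam M j) *
            fockModes.creation (window M) (stateCol A lam M j) := by
      ext1 a
      refine Fin.addCases (fun a => ?_) (fun a => ?_) a
      · rw [hw, hv, Fin.append_left, Fin.append_left, Fin.append_left,
          annihilation_siteVec fockModes (h1 a), creation_siteVec fockModes (h2 a)]
        rfl
      · rw [hw, hv, Fin.append_right, Fin.append_right, Fin.append_right]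
    rw [happ, List.ofFn_fin_append, List.prod_append]
    rfl
  rw [correlatorTerm, hvev, Finset.prod_mul_distrib]
  have hrow : ∏ a, psiDagCoeff (x a)⁻¹ (m a).1 =
      ∏ p : Fin n ⊕ Fin (frobRank lam), Sum.elim (fun a => x a ^ ((m a).1 + 1)) (fun _ => 1) p := by
    simp [psiDagCoeff_inv]
  have hcol : ∏ a, psiCoeff (y a)⁻¹ (m a).2 =
      ∏ p : Fin n ⊕ Fin (frobRank lam), Sum.elim (fun a => y a ^ (-(m a).2)) (fun _ => 1) p := by
    simp [psiCoeff_inv]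
  rw [hrow, hcol, ← Matrix.det_submatrix_equiv_self finSumFinEquiv (wickMatrix w v), mul_assoc,
    ← Matrix.det_mul_row, ← Matrix.det_mul_column]
  congr 1
  ext p q
  simp only [Matrix.of_apply, Matrix.submatrix_apply, wickMatrix]
  rcases p with a | i <;> rcases q with b | j
  · have hle : Fin.castAdd (frobRank lam) a ≤ Fin.castAdd (frobRank lam) b ↔ a ≤ b := Iff.rfl
    simp only [Sum.elim_inl, finSumFinEquiv_apply_left, hw, hv, Fin.append_left, modeEntry,
      extendModes_inl, hle, nonnegPart_siteVec_dotProduct (h1 a),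
      negPart_dotProduct_siteVec (h2 b)]
    simp only [siteVec]
    by_cases hk : (m a).1 = (m b).2
    · simp only [hk, if_true]
      split_ifs <;> ring
    · simp [hk, Ne.symm hk]
  · have : Fin.castAdd (frobRank lam) a ≤ Fin.natAdd n j := by
      rw [Fin.le_def]
      simp only [Fin.val_castAdd, Fin.val_natAdd]
      omega
    simp only [Sum.elim_inl, Sum.elim_inr, finSumFinEquiv_apply_left, finSumFinEquiv_apply_right,
      hw, hv, Fin.append_left, Fin.append_right, modeEntry,
      nonnegPart_siteVec_dotProduct (h1 a), this, if_true, stateCol_apply]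
    rw [extendModes_inl, extendModes_inr, if_pos rfl]
    split_ifs <;> ring
  · have : ¬Fin.natAdd n i ≤ Fin.castAdd (frobRank lam) b := by
      rw [Fin.le_def]
      simp only [Fin.val_castAdd, Fin.val_natAdd]
      omega
    simp only [Sum.elim_inl, Sum.elim_inr, finSumFinEquiv_apply_left, finSumFinEquiv_apply_right,
      hw, hv, Fin.append_left, Fin.append_right, modeEntry,
      negPart_dotProduct_siteVec (h2 b), this, if_false, stateRow_apply]
    rw [extendModes_inl, extendModes_inr, if_pos rfl]
    split_ifs <;> ring
  · have := nonnegPart_dotProduct_add_negPart_dotProduct (stateRow A lam M i) (stateCol A lam M j)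
    rw [stateRow_dotProduct_stateCol hA hcov] at this
    simp only [Sum.elim_inr, finSumFinEquiv_apply_right,
      hw, hv, Fin.append_right, modeEntry, extendModes_inr, if_true, one_mul]
    rw [← eq_neg_of_add_eq_zero_left this, ite_self, nonnegPart_stateRow_dotProduct hA hcov]

end Correlator

section Correlator

variable {A : Matrix ℤ ℤ ℂ} {lam : YoungDiagram} {n : ℕ} {x y : Fin n → ℂ}

lemma RadiallyOrdered.norm_x_lt (h : RadiallyOrdered x y) {a b : Fin n} (hab : a ≤ b) :
    ‖x a‖ < ‖y b‖ := by
  rcases hab.eq_or_lt with rfl | hab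
  · exact h.2.1 a
  · exact (h.2.1 a).trans ((h.2.2 a b hab).trans (h.2.1 b))

lemma RadiallyOrdered.y_ne_zero (h : RadiallyOrdered x y) (a : Fin n) : y a ≠ 0 :=
  norm_pos_iff.1 ((h.1 a).trans (h.2.1 a))

lemma RadiallyOrdered.x_ne_zero (h : RadiallyOrdered x y) (a : Fin n) : x a ≠ 0 :=
  norm_pos_iff.1 (h.1 a)

lemma RadiallyOrdered.x_ne_y (h : RadiallyOrdered x y) (a b : Fin n) : x a ≠ y b := by
  intro heq
  rcases le_or_gt a b with hab | hab
  · exact (h.norm_x_lt hab).ne (by rw [heq])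
  · exact (h.2.2 b a hab).ne (by rw [heq])

lemma RadiallyOrdered.y_injective (h : RadiallyOrdered x y) : Function.Injective y := by
  have key : ∀ a b, a < b → y a ≠ y b := fun a b hab heq =>
    ((h.2.2 a b hab).trans (h.2.1 b)).ne (by rw [heq])
  intro a b hab
  by_contra hne
  rcases lt_or_gt_of_ne hne with h' | h'
  · exact key a b h' hab
  · exact key b a h' hab.symm

lemma hasSum_of_ray {g : ℤ → ℤ → ℂ} {s : ℂ} (e : ℕ → ℤ × ℤ) (he : Function.Injective e)
    (hg : ∀ k l, (∀ i, e i ≠ (k, l)) → g k l = 0)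
    (h : HasSum (fun i => g (e i).1 (e i).2) s) :
    HasSum (fun kl : ℤ × ℤ => g kl.1 kl.2) s := by
  refine (he.hasSum_iff fun kl hkl => ?_).1 h
  exact hg _ _ fun i hi => hkl ⟨i, hi⟩

lemma hasSum_modeEntry_inl_inl (h : RadiallyOrdered x y) (a b : Fin n) :
    HasSum (fun kl : ℤ × ℤ => modeEntry A lam x y (Sum.inl a) (Sum.inl b) kl.1 kl.2)
      (x a * y b / (y b - x a)) := by
  have hx := h.x_ne_zero a
  have hy := h.y_ne_zero b
  have hxy : y b - x a ≠ 0 := sub_ne_zero.2 (h.x_ne_y a b).symm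
  rcases le_or_gt a b with hab | hab
  · refine hasSum_of_ray (fun i : ℕ => ((i : ℤ), (i : ℤ))) (fun i j hij => by simpa using hij) ?_ ?_
    · intro k l hkl
      simp only [modeEntry, if_pos hab]
      split_ifs with h1 h2
      · exact absurd (Prod.ext (by simp [h2]) (by simp [← h1, h2])) (hkl k.toNat)
      · simp
      · rfl
    · have hr : ‖x a / y b‖ < 1 := by
        rw [norm_div, div_lt_one (norm_pos_iff.2 hy)]
        exact h.norm_x_lt hab
      have hs := (hasSum_geometric_of_norm_lt_one hr).mul_left (x a)
      have he : x a * (1 - x a / y b)⁻¹ = x a * y b / (y b - x a) := by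
        rw [one_sub_div hy, inv_div, mul_div_assoc]
      rw [he] at hs
      refine hs.congr_fun fun i => ?_
      simp only [modeEntry, if_true, if_pos hab, if_pos (Int.natCast_nonneg i), mul_one]
      rw [zpow_add_one₀ hx, zpow_neg, zpow_natCast, zpow_natCast, div_pow]
      field_simp
  · refine hasSum_of_ray (fun i : ℕ => (-(i : ℤ) - 1, -(i : ℤ) - 1))
      (fun i j hij => by simpa using hij) ?_ ?_
    · intro k l hkl
      simp only [modeEntry, if_neg hab.not_ge]
      split_ifs with h1 h2
      · simp
      · refine absurd (Prod.ext ?_ ?_) (hkl (-k - 1).toNat) <;> simp only <;> omega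
      · rfl
    · have hr : ‖y b / x a‖ < 1 := by
        rw [norm_div, div_lt_one (norm_pos_iff.2 hx)]
        exact h.2.2 b a hab
      have hs := (hasSum_geometric_of_norm_lt_one hr).mul_left (-y b)
      have hxy' : x a - y b ≠ 0 := sub_ne_zero.2 (h.x_ne_y a b)
      have he : -y b * (1 - y b / x a)⁻¹ = x a * y b / (y b - x a) := by
        rw [one_sub_div hx, inv_div]
        field_simp
        ring
      rw [he] at hs
      refine hs.congr_fun fun i => ?_
      have hi : ¬(0 : ℤ) ≤ -(i : ℤ) - 1 := by omega
      simp only [modeEntry, if_true, if_neg hab.not_ge, if_neg hi]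
      rw [show -(i : ℤ) - 1 + 1 = -(i : ℤ) by ring, show -(-(i : ℤ) - 1) = (i : ℤ) + 1 by ring,
        zpow_add_one₀ hy, zpow_neg, zpow_natCast, zpow_natCast, div_pow]
      field_simp

lemma coeffP_eq_zero (hA : StrictlyUpper A) {j k : ℤ} (h : k < j) : coeffP A j k = 0 :=
  matExp_eq_zero hA h

lemma coeffPStar_eq_zero (hA : StrictlyUpper A) {j k : ℤ} (h : j < k) : coeffPStar A j k = 0 :=
  matExp_eq_zero hA.neg (by omega)

lemma hasSum_modeEntry_inl_inr (hA : StrictlyUpper A) (h : RadiallyOrdered x y) (a : Fin n)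
    (j : Fin (frobRank lam)) :
    HasSum (fun kl : ℤ × ℤ => modeEntry A lam x y (Sum.inl a) (Sum.inr j) kl.1 kl.2)
      (blockW A lam x a j) := by
  refine hasSum_of_ray (fun i : ℕ => ((i : ℤ), 0)) (fun i j hij => by simpa using hij) ?_ ?_
  · intro k l hkl
    simp only [modeEntry]
    split_ifs with h1 h2
    · exact absurd (Prod.ext (by simp [h2]) h1.symm) (hkl k.toNat)
    · rfl
    · rfl
  · have hs := hasSum_sum_of_ne_finset_zero (L := SummationFilter.unconditional ℕ)
      (f := fun i : ℕ => x a * (coeffP A i (arm lam j) * x a ^ i))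
      (s := Finset.range (arm lam j + 1)) fun i hi => by
        rw [coeffP_eq_zero hA, zero_mul, mul_zero]
        simp only [Finset.mem_range] at hi
        omega
    rw [blockW, polyP, Polynomial.eval_finsetSum, Finset.mul_sum]
    simp only [Polynomial.eval_mul, Polynomial.eval_C, Polynomial.eval_pow, Polynomial.eval_X]
    refine hs.congr_fun fun i => ?_
    simp only [modeEntry, if_true, if_pos (Int.natCast_nonneg i)]
    rw [zpow_add_one₀ (h.x_ne_zero a), zpow_natCast]
    ring

lemma hasSum_modeEntry_inr_inl (hA : StrictlyUpper A) (h : RadiallyOrdered x y)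
    (i : Fin (frobRank lam)) (b : Fin n) :
    HasSum (fun kl : ℤ × ℤ => modeEntry A lam x y (Sum.inr i) (Sum.inl b) kl.1 kl.2)
      (blockWStar A lam y i b) := by
  refine hasSum_of_ray (fun i : ℕ => (0, -(i : ℤ) - 1)) (fun i j hij => by simpa using hij) ?_ ?_
  · intro k l hkl
    simp only [modeEntry]
    split_ifs with h1 h2
    · rfl
    · refine absurd (Prod.ext h1.symm ?_) (hkl (-l - 1).toNat)
      simp only
      omega
    · rfl
  · have hs := hasSum_sum_of_ne_finset_zero (L := SummationFilter.unconditional ℕ)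
      (f := fun k : ℕ => (-1) ^ leg lam i * (y b * (coeffPStar A (leg lam i) k * y b ^ k)))
      (s := Finset.range (leg lam i + 1)) fun k hk => by
        rw [coeffPStar_eq_zero hA, zero_mul, mul_zero, mul_zero]
        simp only [Finset.mem_range] at hk
        omega
    rw [blockWStar, polyPStar, Polynomial.eval_finsetSum, Finset.mul_sum, Finset.mul_sum]
    simp only [Polynomial.eval_mul, Polynomial.eval_C, Polynomial.eval_pow, Polynomial.eval_X]
    refine hs.congr_fun fun k => ?_
    have hk : ¬(0 : ℤ) ≤ -(k : ℤ) - 1 := by omega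
    simp only [modeEntry, if_true, if_neg hk]
    rw [show -(-(k : ℤ) - 1) - 1 = (k : ℤ) by ring, show -(-(k : ℤ) - 1) = (k : ℤ) + 1 by ring,
      zpow_add_one₀ (h.y_ne_zero b), zpow_natCast]
    ring

lemma hasSum_modeEntry (hA : StrictlyUpper A) (h : RadiallyOrdered x y)
    (p q : Fin n ⊕ Fin (frobRank lam)) :
    HasSum (fun kl : ℤ × ℤ => modeEntry A lam x y p q kl.1 kl.2) (blockMatrix A lam x y p q) := by
  rcases p with a | i <;> rcases q with b | j
  · exact hasSum_modeEntry_inl_inl h a b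
  · exact hasSum_modeEntry_inl_inr hA h a j
  · exact hasSum_modeEntry_inr_inl hA h i b
  · have hs := hasSum_single (f := fun kl : ℤ × ℤ =>
        modeEntry A lam x y (Sum.inr i) (Sum.inr j) kl.1 kl.2) (0, 0) fun kl hkl => by
      simp only [modeEntry]
      split_ifs with h1 h2
      · exact absurd (Prod.ext h1 h2) hkl
      · rfl
      · rfl
    simpa [modeEntry, blockMatrix] using hs

theorem hasSum_correlatorTerm (hA : StrictlyUpper A) (h : RadiallyOrdered x y) :
    HasSum (correlatorTerm A lam x y) (blockMatrix A lam x y).det := by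
  have hs := hasSum_det _ _ (hasSum_modeEntry (lam := lam) hA h)
  rw [← (extendModes_injective lam (n := n)).hasSum_iff fun kl hkl =>
    det_modeEntry_eq_zero A lam x y hkl] at hs
  exact hs.congr_fun fun m => correlatorTerm_eq_det hA m

theorem correlator_eq_det (hA : StrictlyUpper A) (h : RadiallyOrdered x y) :
    correlator A lam x y = (blockMatrix A lam x y).det :=
  (hasSum_correlatorTerm hA h).tsum_eq

end Correlator

/-! ### Rationality -/

section Rational

open MvPolynomial

variable (A : Matrix ℤ ℤ ℂ) (lam : YoungDiagram) (n : ℕ)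

/-- The block matrix with row `a` multiplied by `∏_b (x_a - y_b)`. -/
def clearedMatrix : Matrix (Fin n ⊕ Fin (frobRank lam)) (Fin n ⊕ Fin (frobRank lam))
    (MvPolynomial (Fin n ⊕ Fin n) ℂ) :=
  Matrix.fromBlocks
    (Matrix.of fun a b => -(X (Sum.inl a) * X (Sum.inr b) *
      ∏ b' ∈ Finset.univ.erase b, (X (Sum.inl a) - X (Sum.inr b'))))
    (Matrix.of fun a j => (∏ b, (X (Sum.inl a) - X (Sum.inr b))) *
      (X (Sum.inl a) * Polynomial.aeval (X (Sum.inl a)) (polyP A (arm lam j))))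
    (Matrix.of fun i b => (-1) ^ leg lam i *
      (X (Sum.inr b) * Polynomial.aeval (X (Sum.inr b)) (polyPStar A (leg lam i))))
    (Matrix.of fun i j => C (blockG A lam i j))

lemma eval_aeval {σ : Type} (f : σ → ℂ) (q : MvPolynomial σ ℂ) (p : Polynomial ℂ) :
    eval f (Polynomial.aeval q p) = p.eval (eval f q) := by
  rw [Polynomial.aeval_def, Polynomial.hom_eval₂, Polynomial.eval]
  congr 1
  ext
  simp

theorem det_blockMatrix_eq_div : ∃ P : MvPolynomial (Fin n ⊕ Fin n) ℂ, ∀ x y : Fin n → ℂ,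
    (∀ a b, x a ≠ y b) → (blockMatrix A lam x y).det =
      eval (Sum.elim x y) P / ∏ a, ∏ b, (x a - y b) := by
  refine ⟨(clearedMatrix A lam n).det, fun x y h => ?_⟩
  have hne : ∏ a, ∏ b, (x a - y b) ≠ 0 :=
    Finset.prod_ne_zero_iff.2 fun a _ => Finset.prod_ne_zero_iff.2 fun b _ => sub_ne_zero.2 (h a b)
  rw [eq_div_iff hne, RingHom.map_det, mul_comm]
  have hprod : ∏ a, ∏ b, (x a - y b) = ∏ p : Fin n ⊕ Fin (frobRank lam),
      Sum.elim (fun a => ∏ b, (x a - y b)) (fun _ => 1) p := by simp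
  rw [hprod, ← Matrix.det_mul_column]
  congr 1
  ext p q
  rcases p with a | i <;> rcases q with b | j
  · have hb : y b - x a ≠ 0 := sub_ne_zero.2 (h a b).symm
    simp only [Matrix.of_apply, Sum.elim_inl, blockMatrix, blockN, Matrix.fromBlocks_apply₁₁,
      RingHom.mapMatrix_apply, Matrix.map_apply, clearedMatrix, map_neg, map_mul, map_prod, map_sub,
      eval_X, Sum.elim_inr]
    rw [← Finset.mul_prod_erase _ _ (Finset.mem_univ b)]
    field_simp
    ring
  · simp only [Matrix.of_apply, Sum.elim_inl, blockMatrix, blockW, Matrix.fromBlocks_apply₁₂,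
      RingHom.mapMatrix_apply, Matrix.map_apply, clearedMatrix, map_mul, map_prod, map_sub,
      eval_X, Sum.elim_inr, eval_aeval]
  · simp only [Matrix.of_apply, Sum.elim_inr, blockMatrix, blockWStar, Matrix.fromBlocks_apply₂₁,
      RingHom.mapMatrix_apply, Matrix.map_apply, clearedMatrix, map_mul, map_pow, map_neg, map_one,
      eval_X, eval_aeval, one_mul]
  · simp only [Matrix.of_apply, Sum.elim_inr, blockMatrix, Matrix.fromBlocks_apply₂₂,
      RingHom.mapMatrix_apply, Matrix.map_apply, clearedMatrix, eval_C, one_mul]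

end Rational

/-! ### Generating series of the shift flows -/

section Series

variable {R : Type*} [CommRing R]

/-- The geometric series `∑ c^i z^i`. -/
def geomSeries (c : R) : PowerSeries R := PowerSeries.mk fun i => c ^ i

/-- The linear factor `1 - c z`. -/
def linFactor (c : R) : PowerSeries R := 1 - PowerSeries.C c * PowerSeries.X

lemma geomSeries_mul_linFactor (c : R) : geomSeries c * linFactor c = 1 := by
  ext i
  rw [linFactor, mul_sub, mul_one, ← mul_assoc, mul_comm (geomSeries c), mul_assoc, map_sub,
    PowerSeries.coeff_C_mul]
  cases i with
  | zero => simp [geomSeries]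
  | succ i =>
    rw [PowerSeries.coeff_succ_mul_X, geomSeries, PowerSeries.coeff_mk, PowerSeries.coeff_mk,
      PowerSeries.coeff_one, if_neg (Nat.succ_ne_zero i), pow_succ']
    ring

/-- The series `∏_a (1 - y_a z) / (1 - x_a z)`. -/
def ratioSeries {n : ℕ} (x y : Fin n → R) : PowerSeries R :=
  ∏ a, linFactor (y a) * geomSeries (x a)

lemma ratioSeries_mul_ratioSeries {n : ℕ} (x y : Fin n → R) :
    ratioSeries y x * ratioSeries x y = 1 := by
  rw [ratioSeries, ratioSeries, ← Finset.prod_mul_distrib]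
  refine Finset.prod_eq_one fun a _ => ?_
  linear_combination linFactor (x a) * geomSeries (x a) * geomSeries_mul_linFactor (y a) +
    geomSeries_mul_linFactor (x a)

lemma constantCoeff_geomSeries (c : R) : PowerSeries.constantCoeff (geomSeries c) = 1 := by
  rw [← PowerSeries.coeff_zero_eq_constantCoeff_apply, geomSeries, PowerSeries.coeff_mk, pow_zero]

lemma constantCoeff_linFactor (c : R) : PowerSeries.constantCoeff (linFactor c) = 1 := by
  simp [linFactor]

lemma constantCoeff_ratioSeries {n : ℕ} (x y : Fin n → R) :
    PowerSeries.constantCoeff (ratioSeries x y) = 1 := by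
  rw [ratioSeries, map_prod]
  refine Finset.prod_eq_one fun a _ => ?_
  rw [map_mul, constantCoeff_geomSeries, constantCoeff_linFactor, one_mul]

lemma map_ratioSeries {S : Type*} [CommRing S] (φ : R →+* S) {n : ℕ} (x y : Fin n → R) :
    (ratioSeries x y).map φ = ratioSeries (fun a => φ (x a)) fun a => φ (y a) := by
  rw [ratioSeries, ratioSeries, map_prod]
  refine Finset.prod_congr rfl fun a _ => ?_
  rw [map_mul]
  congr 1
  · simp [linFactor]
  · ext i
    simp [geomSeries]

/-- `L` is the logarithmic derivative of `F`. -/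
def HasLogDeriv (F L : PowerSeries R) : Prop := PowerSeries.derivative R F = F * L

lemma HasLogDeriv.mul {F G L M : PowerSeries R} (hF : HasLogDeriv F L) (hG : HasLogDeriv G M) :
    HasLogDeriv (F * G) (L + M) := by
  rw [HasLogDeriv] at *
  rw [Derivation.leibniz, hF, hG, smul_eq_mul, smul_eq_mul]
  ring

lemma HasLogDeriv.prod {ι : Type*} (s : Finset ι) {F L : ι → PowerSeries R}
    (h : ∀ i ∈ s, HasLogDeriv (F i) (L i)) : HasLogDeriv (∏ i ∈ s, F i) (∑ i ∈ s, L i) := by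
  induction s using Finset.induction_on with
  | empty => simp [HasLogDeriv]
  | insert a s ha ih =>
    rw [Finset.prod_insert ha, Finset.sum_insert ha]
    exact (h a (Finset.mem_insert_self a s)).mul
      (ih fun i hi => h i (Finset.mem_insert_of_mem hi))

lemma derivative_linFactor (c : R) :
    PowerSeries.derivative R (linFactor c) = -PowerSeries.C c := by
  rw [linFactor, map_sub, Derivation.leibniz]
  simp

lemma hasLogDeriv_linFactor (c : R) :
    HasLogDeriv (linFactor c) (-(PowerSeries.C c * geomSeries c)) := by
  rw [HasLogDeriv, derivative_linFactor]
  linear_combination PowerSeries.C c * geomSeries_mul_linFactor c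

lemma hasLogDeriv_geomSeries (c : R) :
    HasLogDeriv (geomSeries c) (PowerSeries.C c * geomSeries c) := by
  have h := congrArg (PowerSeries.derivative R) (geomSeries_mul_linFactor c)
  rw [Derivation.leibniz, derivative_linFactor, smul_eq_mul, smul_eq_mul, Derivation.map_one_eq_zero]
    at h
  rw [HasLogDeriv]
  linear_combination geomSeries c * h -
    PowerSeries.derivative R (geomSeries c) * geomSeries_mul_linFactor c

lemma HasLogDeriv.eq [IsAddTorsionFree R] {F G G' L M : PowerSeries R} (hF : HasLogDeriv F L)
    (hG : HasLogDeriv G M) (hLM : L + M = 0) (hGG : G * G' = 1)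
    (h0 : PowerSeries.constantCoeff F * PowerSeries.constantCoeff G = 1) : F = G' := by
  have h : F * G = 1 := by
    refine PowerSeries.derivative.ext ?_ (by rw [map_mul, h0, map_one])
    rw [(hF.mul hG), hLM, mul_zero, Derivation.map_one_eq_zero]
  linear_combination G' * h - F * hGG

end Series

/-- The series `∑_{j ≥ 1} t_j z^j`. -/
def flowSeries (t : ℕ+ → ℂ) : PowerSeries ℂ :=
  PowerSeries.mk fun i => if 0 < i then t i.toPNat' else 0

lemma constantCoeff_flowSeries (t : ℕ+ → ℂ) : PowerSeries.constantCoeff (flowSeries t) = 0 := by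
  rw [← PowerSeries.coeff_zero_eq_constantCoeff_apply, flowSeries, PowerSeries.coeff_mk]
  rfl

lemma hasSubst_flowSeries (t : ℕ+ → ℂ) : PowerSeries.HasSubst (flowSeries t) :=
  PowerSeries.HasSubst.of_constantCoeff_zero' (constantCoeff_flowSeries t)

/-- The series `exp (∑_{j ≥ 1} t_j z^j)`. -/
def expSeries (t : ℕ+ → ℂ) : PowerSeries ℂ := (PowerSeries.exp ℂ).subst (flowSeries t)

lemma hasLogDeriv_expSeries (t : ℕ+ → ℂ) :
    HasLogDeriv (expSeries t) (PowerSeries.derivative ℂ (flowSeries t)) := by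
  rw [HasLogDeriv, expSeries, PowerSeries.derivative_subst (hasSubst_flowSeries t),
    PowerSeries.derivative_exp]

lemma constantCoeff_expSeries (t : ℕ+ → ℂ) : PowerSeries.constantCoeff (expSeries t) = 1 := by
  rw [← PowerSeries.coeff_zero_eq_constantCoeff_apply, expSeries,
    PowerSeries.coeff_subst' (hasSubst_flowSeries t), finsum_eq_single _ 0]
  · simp
  · intro d hd
    simp [constantCoeff_flowSeries, hd]

lemma derivative_flowSeries_powerSumDiff {n : ℕ} (x y : Fin n → ℂ) :
    PowerSeries.derivative ℂ (flowSeries (powerSumDiff x y)) =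
      ∑ a, (PowerSeries.C (x a) * geomSeries (x a) - PowerSeries.C (y a) * geomSeries (y a)) := by
  ext i
  have hi : (i : ℂ) + 1 ≠ 0 := by exact_mod_cast Nat.succ_ne_zero i
  rw [PowerSeries.coeff_derivative, flowSeries, PowerSeries.coeff_mk,
    if_pos (Nat.succ_pos i), powerSumDiff, Nat.toPNat'_coe, if_pos (Nat.succ_pos i), map_sum]
  simp only [map_sub, PowerSeries.coeff_C_mul, geomSeries, PowerSeries.coeff_mk]
  push_cast
  rw [mul_comm (1 / _) _, mul_assoc, one_div, inv_mul_cancel₀ hi, mul_one]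
  exact Finset.sum_congr rfl fun a _ => by rw [pow_succ', pow_succ']

lemma expSeries_powerSumDiff {n : ℕ} (x y : Fin n → ℂ) :
    expSeries (powerSumDiff x y) = ratioSeries x y := by
  have hG : HasLogDeriv (ratioSeries y x) (∑ a,
      (-(PowerSeries.C (x a) * geomSeries (x a)) + PowerSeries.C (y a) * geomSeries (y a))) :=
    HasLogDeriv.prod _ fun a _ => (hasLogDeriv_linFactor _).mul (hasLogDeriv_geomSeries _)
  refine (hasLogDeriv_expSeries _).eq hG ?_ (ratioSeries_mul_ratioSeries x y) ?_
  · rw [derivative_flowSeries_powerSumDiff, ← Finset.sum_add_distrib]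
    refine Finset.sum_eq_zero fun a _ => ?_
    ring
  · rw [constantCoeff_expSeries, constantCoeff_ratioSeries, one_mul]

lemma matPow_toeplitz (t : ℕ+ → ℂ) (m : ℕ) (i j : ℤ) (hij : i ≤ j) :
    matPow (toeplitz t) m i j = PowerSeries.coeff (j - i).toNat (flowSeries t ^ m) := by
  have hT := toeplitz_strictlyUpper t
  induction m generalizing i with
  | zero =>
    rw [matPow, pow_zero, PowerSeries.coeff_one]
    rcases hij.eq_or_lt with rfl | h
    · simp
    · rw [Matrix.one_apply_ne h.ne, if_neg (by omega)]
  | succ m ih =>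
    rw [matPow_succ_apply, pow_succ', PowerSeries.coeff_mul,
      Finset.Nat.sum_antidiagonal_eq_sum_range_succ_mk,
      finsum_eq_sum_of_support_subset
        (s := (Finset.range ((j - i).toNat + 1)).image fun p : ℕ => i + (p : ℤ)),
      Finset.sum_image]
    · refine Finset.sum_congr rfl fun p hp => ?_
      simp only [Finset.mem_range] at hp
      rw [ih _ (by omega)]
      congr 1
      · rw [toeplitz, Matrix.of_apply, flowSeries, PowerSeries.coeff_mk]
        simp
      · congr 2
        omega
    · intro p _ q _ hpq
      simpa using hpq
    · intro k hk
      have h1 : i < k := by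
        by_contra! h
        exact hk (by dsimp only; rw [hT _ _ h, zero_mul])
      have h2 : k ≤ j := by
        by_contra! h
        exact hk (by dsimp only; rw [matPow_eq_zero hT m k j (by omega), mul_zero])
      simp only [Finset.coe_image, Set.mem_image, Finset.mem_coe, Finset.mem_range]
      exact ⟨(k - i).toNat, by omega, by omega⟩

lemma matExp_toeplitz (t : ℕ+ → ℂ) (i j : ℤ) :
    matExp (toeplitz t) i j = if i ≤ j then PowerSeries.coeff (j - i).toNat (expSeries t) else 0 := by
  split_ifs with hij
  · rw [expSeries, PowerSeries.coeff_subst' (hasSubst_flowSeries t), matExp]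
    refine finsum_congr fun m => ?_
    rw [matPow_toeplitz t m i j hij, PowerSeries.coeff_exp, smul_eq_mul]
    simp
  · exact matExp_eq_zero (toeplitz_strictlyUpper t) (not_le.1 hij)

lemma powerSumDiff_neg {n : ℕ} (x y : Fin n → ℂ) : -powerSumDiff x y = powerSumDiff y x := by
  ext j
  rw [Pi.neg_apply, powerSumDiff, powerSumDiff, ← mul_neg, ← Finset.sum_neg_distrib]
  simp

/-! ### Partial fractions -/

section PartialFractions

variable {n : ℕ} {x y : Fin n → ℂ}

/-- The residue of `∏_a (z - x_a) / (z - y_a)` at `z = y_b`. -/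
def residue (x y : Fin n → ℂ) (b : Fin n) : ℂ :=
  (∏ a, (y b - x a)) / ∏ b' ∈ Finset.univ.erase b, (y b - y b')

lemma prod_sub_eq (hy : Function.Injective y) (z : ℂ) :
    ∏ a, (z - x a) = ∏ a, (z - y a) +
      ∑ b, residue x y b * ∏ b' ∈ Finset.univ.erase b, (z - y b') := by
  set p : Polynomial ℂ := ∏ a, (Polynomial.X - Polynomial.C (x a)) with hp
  set q : Polynomial ℂ := ∏ a, (Polynomial.X - Polynomial.C (y a)) with hq
  have hpm : p.Monic := Polynomial.monic_prod_X_sub_C _ _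
  have hqm : q.Monic := Polynomial.monic_prod_X_sub_C _ _
  have hpd : p.degree = n := by
    rw [hp, Polynomial.degree_prod]
    simp
  have hqd : q.degree = n := by
    rw [hq, Polynomial.degree_prod]
    simp
  have hdeg : (p - q).degree < (Finset.univ : Finset (Fin n)).card := by
    rw [Finset.card_univ, Fintype.card_fin, ← hpd]
    exact Polynomial.degree_sub_lt_left (hpd.trans hqd.symm) hpm.ne_zero
      (hpm.leadingCoeff.trans hqm.leadingCoeff.symm)
  have h := Lagrange.eq_interpolate (v := y) hy.injOn hdeg
  have h2 := congrArg (Polynomial.eval z) h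
  rw [Polynomial.eval_sub, Lagrange.interpolate_apply, Polynomial.eval_finsetSum] at h2
  have hpe : ∀ z, p.eval z = ∏ a, (z - x a) := fun z => by simp [hp, Polynomial.eval_prod]
  have hqe : ∀ z, q.eval z = ∏ a, (z - y a) := fun z => by simp [hq, Polynomial.eval_prod]
  rw [← hpe, ← hqe, eq_add_of_sub_eq' h2]
  congr 1
  refine Finset.sum_congr rfl fun b _ => ?_
  rw [Polynomial.eval_mul, Polynomial.eval_C, Polynomial.eval_sub, hpe, hqe,
    Finset.prod_eq_zero (f := fun a => y b - y a) (Finset.mem_univ b) (sub_self (y b)), sub_zero, residue, Lagrange.basis,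
    Polynomial.eval_prod, div_mul_eq_mul_div, mul_div_assoc, ← Finset.prod_div_distrib]
  congr 1
  refine Finset.prod_congr rfl fun b' _ => ?_
  rw [Lagrange.basisDivisor, Polynomial.eval_mul, Polynomial.eval_C, Polynomial.eval_sub,
    Polynomial.eval_X, Polynomial.eval_C, div_eq_inv_mul]

lemma sum_residue_div (hy : Function.Injective y) (hxy : ∀ a b, x a ≠ y b) (a : Fin n) :
    ∑ b, residue x y b / (y b - x a) = 1 := by
  have h := prod_sub_eq (x := x) hy (x a)
  rw [Finset.prod_eq_zero (Finset.mem_univ a) (sub_self (x a))] at h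
  have hne : ∏ b, (x a - y b) ≠ 0 :=
    Finset.prod_ne_zero_iff.2 fun b _ => sub_ne_zero.2 (hxy a b)
  have h2 : ∑ b, residue x y b * ∏ b' ∈ Finset.univ.erase b, (x a - y b') =
      -(∑ b, residue x y b / (y b - x a)) * ∏ b, (x a - y b) := by
    rw [neg_mul, Finset.sum_mul, ← Finset.sum_neg_distrib]
    refine Finset.sum_congr rfl fun b _ => ?_
    have h3 : y b - x a ≠ 0 := sub_ne_zero.2 (hxy a b).symm
    rw [← Finset.mul_prod_erase _ _ (Finset.mem_univ b)]
    field_simp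
    ring
  rw [h2] at h
  have h4 : (1 - ∑ b, residue x y b / (y b - x a)) * ∏ b, (x a - y b) = 0 := by
    linear_combination -h
  rcases mul_eq_zero.1 h4 with h5 | h5
  · exact (sub_eq_zero.1 h5).symm
  · exact absurd h5 hne

lemma prod_one_sub_eq (hy : Function.Injective y) (w : ℂ) :
    ∏ a, (1 - x a * w) = ∏ a, (1 - y a * w) +
      w * ∑ b, residue x y b * ∏ b' ∈ Finset.univ.erase b, (1 - y b' * w) := by
  rcases eq_or_ne w 0 with rfl | hw
  · simp
  · have h := prod_sub_eq (x := x) hy w⁻¹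
    have hfac : ∀ (s : Finset (Fin n)) (c : Fin n → ℂ),
        ∏ a ∈ s, (1 - c a * w) = w ^ s.card * ∏ a ∈ s, (w⁻¹ - c a) := by
      intro s c
      rw [← Finset.prod_const, ← Finset.prod_mul_distrib]
      refine Finset.prod_congr rfl fun a _ => ?_
      rw [mul_sub, mul_inv_cancel₀ hw, mul_comm]
    rw [hfac, hfac, h, mul_add, Finset.mul_sum, Finset.mul_sum]
    congr 1
    refine Finset.sum_congr rfl fun b _ => ?_
    rw [hfac, Finset.card_erase_of_mem (Finset.mem_univ b), Finset.card_univ, Fintype.card_fin]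
    obtain ⟨k, hk⟩ : ∃ k, n = k + 1 := ⟨n - 1, by have := b.2; omega⟩
    have : w ^ n = w * w ^ (n - 1) := by
      rw [hk, Nat.add_sub_cancel, pow_succ']
    rw [this]
    ring

lemma prod_linFactor_eq (hy : Function.Injective y) :
    ∏ a, linFactor (x a) = ∏ a, linFactor (y a) + PowerSeries.X *
      ∑ b, PowerSeries.C (residue x y b) * ∏ b' ∈ Finset.univ.erase b, linFactor (y b') := by
  have hpoly : ∏ a, (1 - Polynomial.C (x a) * Polynomial.X) =
      ∏ a, (1 - Polynomial.C (y a) * Polynomial.X) + Polynomial.X *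
        ∑ b, Polynomial.C (residue x y b) *
          ∏ b' ∈ Finset.univ.erase b, (1 - Polynomial.C (y b') * Polynomial.X) := by
    refine Polynomial.funext fun w => ?_
    simp only [Polynomial.eval_prod, Polynomial.eval_add, Polynomial.eval_mul,
      Polynomial.eval_finsetSum, Polynomial.eval_sub, Polynomial.eval_one, Polynomial.eval_C,
      Polynomial.eval_X]
    exact prod_one_sub_eq hy w
  have h := congrArg (Polynomial.coeToPowerSeries.ringHom (R := ℂ)) hpoly
  simpa only [linFactor, map_prod, map_sub, map_one, map_mul, map_add, map_sum,
    Polynomial.coeToPowerSeries.ringHom_apply, Polynomial.coe_C, Polynomial.coe_X] using h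

lemma ratioSeries_eq_partialFractions (hy : Function.Injective y) :
    ratioSeries y x = 1 + PowerSeries.X *
      ∑ b, PowerSeries.C (residue x y b) * geomSeries (y b) := by
  have hinv : ∀ s : Finset (Fin n),
      (∏ a ∈ s, linFactor (y a)) * ∏ a ∈ s, geomSeries (y a) = 1 := by
    intro s
    rw [← Finset.prod_mul_distrib]
    refine Finset.prod_eq_one fun a _ => ?_
    rw [mul_comm, geomSeries_mul_linFactor]
  rw [ratioSeries, Finset.prod_mul_distrib, prod_linFactor_eq hy, add_mul, hinv, mul_assoc,
    Finset.sum_mul]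
  congr 2
  refine Finset.sum_congr rfl fun b _ => ?_
  rw [← Finset.mul_prod_erase _ (fun a => geomSeries (y a)) (Finset.mem_univ b)]
  linear_combination PowerSeries.C (residue x y b) * geomSeries (y b) * hinv (Finset.univ.erase b)

lemma coeff_succ_ratioSeries (hy : Function.Injective y) (i : ℕ) :
    PowerSeries.coeff (i + 1) (ratioSeries y x) = ∑ b, residue x y b * y b ^ i := by
  rw [ratioSeries_eq_partialFractions hy, map_add, PowerSeries.coeff_succ_X_mul, map_sum,
    PowerSeries.coeff_one, if_neg (Nat.succ_ne_zero i), zero_add]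
  simp [geomSeries, PowerSeries.coeff_C_mul]

/-- The residues at `z = y_b` of the rational function that vanishes at infinity, has its poles
among the `y_b`, and interpolates `z^l` at the `x_a`. -/
def interpResidue (x y : Fin n → ℂ) (l : ℕ) (b : Fin n) : ℂ :=
  ∑ k ∈ Finset.range (l + 1),
    PowerSeries.coeff (l - k) (ratioSeries x y) * y b ^ k * residue x y b

lemma interpResidue_succ (l : ℕ) (b : Fin n) :
    interpResidue x y (l + 1) b = y b * interpResidue x y l b +
      PowerSeries.coeff (l + 1) (ratioSeries x y) * residue x y b := by
  rw [interpResidue, Finset.sum_range_succ', interpResidue, Finset.mul_sum]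
  congr 1
  · refine Finset.sum_congr rfl fun k _ => ?_
    rw [Nat.add_sub_add_right, pow_succ']
    ring
  · simp

lemma sum_interpResidue_mul_pow (hy : Function.Injective y) (l m : ℕ) :
    ∑ b, interpResidue x y l b * y b ^ m = ∑ k ∈ Finset.range (l + 1),
      PowerSeries.coeff (l - k) (ratioSeries x y) *
        PowerSeries.coeff (k + m + 1) (ratioSeries y x) := by
  simp only [interpResidue, Finset.sum_mul]
  rw [Finset.sum_comm]
  refine Finset.sum_congr rfl fun k _ => ?_
  rw [coeff_succ_ratioSeries hy, Finset.mul_sum]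
  refine Finset.sum_congr rfl fun b _ => ?_
  rw [pow_add]
  ring

lemma sum_interpResidue (hy : Function.Injective y) (l : ℕ) :
    ∑ b, interpResidue x y l b = -PowerSeries.coeff (l + 1) (ratioSeries x y) := by
  have h := sum_interpResidue_mul_pow (x := x) hy l 0
  simp only [pow_zero, mul_one, add_zero] at h
  have h2 := congrArg (PowerSeries.coeff (l + 1)) (ratioSeries_mul_ratioSeries x y)
  rw [PowerSeries.coeff_mul, Finset.Nat.sum_antidiagonal_eq_sum_range_succ_mk,
    Finset.sum_range_succ', PowerSeries.coeff_one, if_neg (Nat.succ_ne_zero l)] at h2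
  simp only [PowerSeries.coeff_zero_eq_constantCoeff_apply, constantCoeff_ratioSeries, one_mul,
    Nat.add_sub_add_right, Nat.sub_zero] at h2
  have h3 : ∑ k ∈ Finset.range (l + 1), PowerSeries.coeff (l - k) (ratioSeries x y) *
      PowerSeries.coeff (k + 1) (ratioSeries y x) = ∑ k ∈ Finset.range (l + 1),
      PowerSeries.coeff (k + 1) (ratioSeries y x) * PowerSeries.coeff (l - k) (ratioSeries x y) :=
    Finset.sum_congr rfl fun k _ => mul_comm _ _
  rw [h]
  linear_combination h3 + h2

lemma sum_interpResidue_div (hy : Function.Injective y) (hxy : ∀ a b, x a ≠ y b) (l : ℕ)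
    (a : Fin n) : ∑ b, interpResidue x y l b / (y b - x a) = x a ^ l := by
  induction l with
  | zero =>
    rw [pow_zero, ← sum_residue_div hy hxy a]
    refine Finset.sum_congr rfl fun b _ => ?_
    simp [interpResidue, constantCoeff_ratioSeries]
  | succ l ih =>
    have hb : ∀ b, interpResidue x y (l + 1) b / (y b - x a) = interpResidue x y l b +
        x a * (interpResidue x y l b / (y b - x a)) +
        PowerSeries.coeff (l + 1) (ratioSeries x y) * (residue x y b / (y b - x a)) := by
      intro b
      have h3 : y b - x a ≠ 0 := sub_ne_zero.2 (hxy a b).symm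
      rw [interpResidue_succ]
      field_simp
      ring
    rw [Finset.sum_congr rfl fun b _ => hb b, Finset.sum_add_distrib, Finset.sum_add_distrib,
      ← Finset.mul_sum, ← Finset.mul_sum, ih, sum_residue_div hy hxy, sum_interpResidue hy, pow_succ']
    ring

end PartialFractions

/-! ### The tau function at a difference of power sums -/

section Flow

variable {n : ℕ} {x y : Fin n → ℂ}

lemma exp_trunc_toeplitz (x y : Fin n → ℂ) (M : ℕ) (k l : window M) :
    IsNilpotent.exp (trunc M (toeplitz (powerSumDiff x y))) k l =
      if (k : ℤ) ≤ l then PowerSeries.coeff ((l : ℤ) - k).toNat (ratioSeries x y) else 0 := by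
  rw [← matExp_eq_exp_trunc (toeplitz_strictlyUpper _), matExp_toeplitz, expSeries_powerSumDiff]

lemma exp_neg_trunc_toeplitz (x y : Fin n → ℂ) (M : ℕ) (k l : window M) :
    IsNilpotent.exp (-trunc M (toeplitz (powerSumDiff x y))) k l =
      if (k : ℤ) ≤ l then PowerSeries.coeff ((l : ℤ) - k).toNat (ratioSeries y x) else 0 := by
  rw [show -trunc M (toeplitz (powerSumDiff x y)) = trunc M (-toeplitz (powerSumDiff x y)) from rfl,
    ← toeplitz_neg, powerSumDiff_neg, exp_trunc_toeplitz]

/-- The pairing of sites after the flow. -/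
def flowKernel (M : ℕ) (t : ℕ+ → ℂ) (m l : window M) : ℂ :=
  ∑ k : window M, if 0 ≤ (k : ℤ) then
    IsNilpotent.exp (-trunc M (toeplitz t)) m k * IsNilpotent.exp (trunc M (toeplitz t)) k l else 0

lemma nonnegPart_vecMul_dotProduct_mulVec (M : ℕ) (t : ℕ+ → ℂ) (w v : window M → ℂ) :
    nonnegPart (Matrix.vecMul w (IsNilpotent.exp (-trunc M (toeplitz t)))) ⬝ᵥ
        Matrix.mulVec (IsNilpotent.exp (trunc M (toeplitz t))) v =
      ∑ m, ∑ l, w m * flowKernel M t m l * v l := by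
  have h : ∀ m l, w m * flowKernel M t m l * v l = ∑ k : window M, if 0 ≤ (k : ℤ) then
      (w m * IsNilpotent.exp (-trunc M (toeplitz t)) m k) *
        (IsNilpotent.exp (trunc M (toeplitz t)) k l * v l) else 0 := by
    intro m l
    rw [flowKernel, Finset.mul_sum, Finset.sum_mul]
    refine Finset.sum_congr rfl fun k _ => ?_
    split_ifs <;> ring
  simp only [h]
  rw [nonnegPart_dotProduct_eq, Finset.sum_congr rfl fun m _ => Finset.sum_comm, Finset.sum_comm]
  refine Finset.sum_congr rfl fun k _ => ?_
  split_ifs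
  · rw [Matrix.vecMul, Matrix.mulVec, dotProduct, dotProduct, Finset.sum_mul_sum]
  · simp

lemma flowKernel_of_nonneg (M : ℕ) (t : ℕ+ → ℂ) {m : window M} (hm : 0 ≤ (m : ℤ)) (l : window M) :
    flowKernel M t m l = if m = l then 1 else 0 := by
  have hT := toeplitz_strictlyUpper t
  have h := congrArg (fun B : Matrix (window M) (window M) ℂ => B m l)
    (IsNilpotent.exp_neg_mul_exp_self (trunc_isNilpotent hT M))
  rw [Matrix.one_apply, Matrix.mul_apply] at h
  rw [← h, flowKernel]
  refine Finset.sum_congr rfl fun k _ => ?_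
  split_ifs with hk
  · rfl
  · rw [show -trunc M (toeplitz t) = trunc M (-toeplitz t) from rfl,
      ← matExp_eq_exp_trunc hT.neg, matExp_eq_zero hT.neg (by omega), zero_mul]

lemma flowKernel_of_neg (hy : Function.Injective y) (hy0 : ∀ b, y b ≠ 0) {M : ℕ} {m : window M}
    (hm : (m : ℤ) < 0) (l : window M) :
    flowKernel M (powerSumDiff x y) m l = if 0 ≤ (l : ℤ) then
      ∑ b, interpResidue x y (l : ℤ).toNat b / y b * y b ^ (-(m : ℤ)).toNat else 0 := by
  rw [flowKernel]
  simp only [exp_trunc_toeplitz, exp_neg_trunc_toeplitz]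
  rw [sum_window_nonneg M fun k : ℤ =>
    (if (m : ℤ) ≤ k then PowerSeries.coeff (k - m).toNat (ratioSeries y x) else 0) *
      if k ≤ l then PowerSeries.coeff ((l : ℤ) - k).toNat (ratioSeries x y) else 0]
  split_ifs with hl
  · obtain ⟨l', hl'⟩ := Int.eq_ofNat_of_zero_le hl
    obtain ⟨m', hm'⟩ : ∃ m' : ℕ, (-(m : ℤ)).toNat = m' + 1 := ⟨(-(m : ℤ)).toNat - 1, by omega⟩
    have hlM := (mem_window.1 l.2).2
    rw [sum_range_eq_of_eq_zero (N := l' + 1) (by omega) fun k hk => by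
      rw [if_neg (show ¬(k : ℤ) ≤ l by omega), mul_zero], hl', hm']
    have h1 : ∀ b, interpResidue x y (l' : ℤ).toNat b / y b * y b ^ (m' + 1) =
        interpResidue x y l' b * y b ^ m' := by
      intro b
      rw [pow_succ', ← mul_assoc, div_mul_cancel₀ _ (hy0 b), Int.toNat_natCast]
    rw [Finset.sum_congr rfl fun b _ => h1 b, sum_interpResidue_mul_pow hy]
    refine Finset.sum_congr rfl fun k hk => ?_
    simp only [Finset.mem_range] at hk
    rw [if_pos (by omega), if_pos (by omega), mul_comm]
    congr 3 <;> omega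
  · refine Finset.sum_eq_zero fun k _ => ?_
    rw [if_neg (show ¬(k : ℤ) ≤ l by omega), mul_zero]

variable {A : Matrix ℤ ℤ ℂ} {lam : YoungDiagram}

/-- The coefficients of the column operation that clears the upper right block. -/
def clearingMatrix (A : Matrix ℤ ℤ ℂ) (lam : YoungDiagram) (x y : Fin n → ℂ) :
    Matrix (Fin n) (Fin (frobRank lam)) ℂ := Matrix.of fun b j =>
  ∑ l ∈ Finset.range (arm lam j + 1), coeffP A l (arm lam j) * (interpResidue x y l b / y b)

lemma blockN_mul_clearingMatrix (hy : Function.Injective y) (hy0 : ∀ b, y b ≠ 0)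
    (hxy : ∀ a b, x a ≠ y b) : blockN x y * clearingMatrix A lam x y = blockW A lam x := by
  ext a j
  rw [Matrix.mul_apply, blockW, polyP, Polynomial.eval_finsetSum, Finset.mul_sum]
  simp only [clearingMatrix, Matrix.of_apply, Finset.mul_sum]
  rw [Finset.sum_comm]
  refine Finset.sum_congr rfl fun l _ => ?_
  rw [Polynomial.eval_mul, Polynomial.eval_C, Polynomial.eval_pow, Polynomial.eval_X,
    ← sum_interpResidue_div hy hxy l a, Finset.mul_sum, Finset.mul_sum]
  refine Finset.sum_congr rfl fun b _ => ?_
  have h1 := hy0 b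
  have h2 : y b - x a ≠ 0 := sub_ne_zero.2 (hxy a b).symm
  rw [blockN]
  field_simp

lemma sum_stateRow_neg (hA : StrictlyUpper A) {M : ℕ} (h : Covers M lam)
    (i : Fin (frobRank lam)) (b : Fin n) :
    (∑ m : window M, if 0 ≤ (m : ℤ) then 0 else
      stateRow A lam M i m * y b ^ (-(m : ℤ)).toNat) = -blockWStar A lam y i b := by
  simp only [stateRow_apply]
  rw [sum_window_neg M fun m : ℤ => (-1 : ℂ) ^ (leg lam i + 1) *
      coeffPStar A (leg lam i) (-m - 1) * y b ^ (-m).toNat,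
    sum_range_eq_of_eq_zero (N := leg lam i + 1) (h i).2, blockWStar, polyPStar,
    Polynomial.eval_finsetSum, Finset.mul_sum, Finset.mul_sum, ← Finset.sum_neg_distrib]
  · refine Finset.sum_congr rfl fun k _ => ?_
    rw [Polynomial.eval_mul, Polynomial.eval_C, Polynomial.eval_pow, Polynomial.eval_X,
      show -(-(k : ℤ) - 1) - 1 = k by ring, show (-(-(k : ℤ) - 1)).toNat = k + 1 by omega]
    ring
  · intro k hk
    rw [coeffPStar_eq_zero hA (by omega)]
    simp

lemma sum_stateCol_nonneg (hA : StrictlyUpper A) {M : ℕ} (h : Covers M lam)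
    (j : Fin (frobRank lam)) (b : Fin n) :
    (∑ l : window M, if 0 ≤ (l : ℤ) then
      stateCol A lam M j l * (interpResidue x y (l : ℤ).toNat b / y b) else 0) =
        clearingMatrix A lam x y b j := by
  simp only [stateCol_apply]
  rw [sum_window_nonneg M fun l : ℤ => coeffP A l (arm lam j) *
      (interpResidue x y l.toNat b / y b),
    sum_range_eq_of_eq_zero (N := arm lam j + 1) (h j).1, clearingMatrix, Matrix.of_apply]
  · refine Finset.sum_congr rfl fun k _ => ?_
    rw [Int.toNat_natCast]
  · intro k hk
    rw [coeffP_eq_zero hA (by omega), zero_mul]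

lemma nonnegPart_flow (hA : StrictlyUpper A) {M : ℕ} (h : Covers M lam)
    (hy : Function.Injective y) (hy0 : ∀ b, y b ≠ 0) (i j : Fin (frobRank lam)) :
    nonnegPart (flowRow A lam M (powerSumDiff x y) i) ⬝ᵥ
        flowCol A lam M (powerSumDiff x y) j =
      (blockG A lam - blockWStar A lam y * clearingMatrix A lam x y) i j := by
  rw [flowRow, flowCol, nonnegPart_vecMul_dotProduct_mulVec, Matrix.sub_apply, Matrix.mul_apply,
    ← nonnegPart_stateRow_dotProduct hA h, nonnegPart_dotProduct_eq, sub_eq_add_neg,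
    ← Finset.sum_neg_distrib]
  simp only [← neg_mul, ← sum_stateRow_neg hA h, ← sum_stateCol_nonneg hA h, Finset.sum_mul_sum]
  rw [Finset.sum_comm (s := (Finset.univ : Finset (Fin n))), ← Finset.sum_add_distrib]
  refine Finset.sum_congr rfl fun m _ => ?_
  rw [Finset.sum_comm (s := (Finset.univ : Finset (Fin n)))]
  split_ifs with hm
  · rw [Finset.sum_eq_single m]
    · rw [flowKernel_of_nonneg M _ hm, if_pos rfl]
      simp
    · intro l _ hl
      rw [flowKernel_of_nonneg M _ hm, if_neg hl.symm, mul_zero, zero_mul]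
    · simp
  · rw [zero_add]
    refine Finset.sum_congr rfl fun l _ => ?_
    rw [flowKernel_of_neg hy hy0 (not_le.1 hm)]
    split_ifs
    · rw [Finset.mul_sum, Finset.sum_mul]
      refine Finset.sum_congr rfl fun b _ => ?_
      ring
    · simp

lemma tau_powerSumDiff (hA : StrictlyUpper A) (hy : Function.Injective y) (hy0 : ∀ b, y b ≠ 0) :
    tau A lam (powerSumDiff x y) =
      (blockG A lam - blockWStar A lam y * clearingMatrix A lam x y).det := by
  obtain ⟨M, hM⟩ := exists_covers lam
  rw [tau_eq_det hA (hM M le_rfl)]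
  congr 1
  ext i j
  exact nonnegPart_flow hA (hM M le_rfl) hy hy0 i j

lemma det_blockN (x y : Fin n → ℂ) :
    (blockN x y).det = (-1) ^ n * (∏ a, x a * y a) * cauchyDet x y := by
  have h : blockN x y = Matrix.of fun a b => x a * (Matrix.of fun a b => -y b *
      (Matrix.of (fun a b : Fin n => 1 / (x a - y b))) a b) a b := by
    ext a b
    simp only [blockN, Matrix.of_apply]
    rw [← neg_sub (x a) (y b), div_neg]
    ring
  rw [h, Matrix.det_mul_column, Matrix.det_mul_row, cauchyDet, Finset.prod_mul_distrib,
    Finset.prod_neg, Finset.card_univ, Fintype.card_fin]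
  ring

theorem det_blockMatrix_eq_tau (hA : StrictlyUpper A) (hy : Function.Injective y)
    (hy0 : ∀ b, y b ≠ 0) (hxy : ∀ a b, x a ≠ y b) :
    (blockMatrix A lam x y).det = (-1) ^ n * (∏ a, x a * y a) * cauchyDet x y *
      tau A lam (powerSumDiff x y) := by
  have hmul : blockMatrix A lam x y *
      Matrix.fromBlocks 1 (-clearingMatrix A lam x y) 0 1 =
      Matrix.fromBlocks (blockN x y) 0 (blockWStar A lam y)
        (blockG A lam - blockWStar A lam y * clearingMatrix A lam x y) := by
    rw [blockMatrix, Matrix.fromBlocks_multiply, ← blockN_mul_clearingMatrix hy hy0 hxy]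
    congr 1 <;> simp [sub_eq_neg_add]
  have hdet := congrArg Matrix.det hmul
  rw [Matrix.det_mul, Matrix.det_fromBlocks_zero₂₁, Matrix.det_fromBlocks_zero₁₂, Matrix.det_one,
    Matrix.det_one, mul_one, mul_one] at hdet
  rw [hdet, det_blockN, tau_powerSumDiff hA hy hy0]

end Flow

/-! ### Polynomiality of the tau function -/

section Polynomiality

open MvPolynomial

/-- The ratio series with indeterminate arguments. -/
def genericRatioSeries (n : ℕ) (swap : Bool) :
    PowerSeries (MvPolynomial (Fin n ⊕ Fin n) ℂ) :=
  if swap then ratioSeries (fun a => X (Sum.inr a)) fun a => X (Sum.inl a)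
  else ratioSeries (fun a => X (Sum.inl a)) fun a => X (Sum.inr a)

lemma eval_coeff_genericRatioSeries {n : ℕ} (swap : Bool) (x y : Fin n → ℂ) (i : ℕ) :
    eval (Sum.elim x y) (PowerSeries.coeff i (genericRatioSeries n swap)) =
      PowerSeries.coeff i (if swap then ratioSeries y x else ratioSeries x y) := by
  rw [← PowerSeries.coeff_map, genericRatioSeries]
  cases swap <;> simp [map_ratioSeries]

theorem exists_tau_eq_eval {A : Matrix ℤ ℤ ℂ} (hA : StrictlyUpper A) (lam : YoungDiagram) (n : ℕ) :
    ∃ Q : MvPolynomial (Fin n ⊕ Fin n) ℂ, ∀ x y : Fin n → ℂ,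
      tau A lam (powerSumDiff x y) = eval (Sum.elim x y) Q := by
  obtain ⟨M, hM⟩ := exists_covers lam
  let E : Bool → window M → window M → MvPolynomial (Fin n ⊕ Fin n) ℂ := fun s k l =>
    if (k : ℤ) ≤ l then PowerSeries.coeff ((l : ℤ) - k).toNat (genericRatioSeries n s) else 0
  refine ⟨(Matrix.of fun i j => ∑ k : window M, if 0 ≤ (k : ℤ) then
    (∑ m, C (stateRow A lam M i m) * E true m k) * ∑ l, E false k l * C (stateCol A lam M j l)
    else 0).det, fun x y => ?_⟩
  rw [tau_eq_det hA (hM M le_rfl), RingHom.map_det]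
  congr 1
  ext i j
  rw [Matrix.of_apply, RingHom.mapMatrix_apply, Matrix.map_apply, Matrix.of_apply,
    nonnegPart_dotProduct_eq, map_sum]
  refine Finset.sum_congr rfl fun k _ => ?_
  have hE : ∀ s m k, eval (Sum.elim x y) (E s m k) = if (m : ℤ) ≤ k then
      PowerSeries.coeff ((k : ℤ) - m).toNat (if s then ratioSeries y x else ratioSeries x y)
        else 0 := by
    intro s m k
    dsimp only [E]
    split_ifs <;> simp [eval_coeff_genericRatioSeries, *]
  split_ifs
  · rw [map_mul, map_sum, map_sum, flowRow, flowCol, Matrix.vecMul, Matrix.mulVec, dotProduct,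
      dotProduct]
    simp only [map_mul, hE, eval_C, exp_trunc_toeplitz, exp_neg_trunc_toeplitz, if_true,
      Bool.false_eq_true, if_false]
  · rw [map_zero]

end Polynomiality

end

end KPFock

theorem proposition5p1 (A : Matrix ℤ ℤ ℂ) (hA : KPFock.StrictlyUpper A)
    (lam : YoungDiagram) (n : ℕ) :
    -- the determinantal formula
    (∀ x y : Fin n → ℂ, KPFock.RadiallyOrdered x y →
      Summable (KPFock.correlatorTerm A lam x y) ∧
      KPFock.correlator A lam x y = (KPFock.blockMatrix A lam x y).det) ∧
    -- it is a rational function with at most simple poles, along `x_a = y_b`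
    (∃ P : MvPolynomial (Fin n ⊕ Fin n) ℂ, ∀ x y : Fin n → ℂ, (∀ a b, x a ≠ y b) →
      (KPFock.blockMatrix A lam x y).det =
        MvPolynomial.eval (Sum.elim x y) P / ∏ a, ∏ b, (x a - y b)) ∧
    -- the tau function at the difference of power sums
    (∀ x y : Fin n → ℂ, KPFock.RadiallyOrdered x y →
      KPFock.correlator A lam x y =
        (-1) ^ n * (∏ a, x a * y a) * KPFock.cauchyDet x y *
          KPFock.tau A lam (KPFock.powerSumDiff x y)) ∧
    (∃ Q : MvPolynomial (Fin n ⊕ Fin n) ℂ, ∀ x y : Fin n → ℂ,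
      (∏ a, x a * y a) * KPFock.tau A lam (KPFock.powerSumDiff x y) =
        MvPolynomial.eval (Sum.elim x y) Q) := by
  refine ⟨fun x y h => ⟨(KPFock.hasSum_correlatorTerm hA h).summable,
      KPFock.correlator_eq_det hA h⟩, KPFock.det_blockMatrix_eq_div A lam n, fun x y h => ?_, ?_⟩
  · rw [KPFock.correlator_eq_det hA h, KPFock.det_blockMatrix_eq_tau hA h.y_injective h.y_ne_zero
      h.x_ne_y]
  · obtain ⟨Q, hQ⟩ := KPFock.exists_tau_eq_eval hA lam n
    refine ⟨(∏ a, MvPolynomial.X (Sum.inl a) * MvPolynomial.X (Sum.inr a)) * Q, fun x y => ?_⟩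
    rw [hQ, map_mul, map_prod]
    simp
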